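/- All vector spaces and Lie algebras are real and finite-dimensional. A $G_2$-structure on a seven-dimensional Lie algebra $\mathfrak g$ is a three-form $\varphi\in\Lambda^3\mathfrak g^*$ for which there is a basis $e_1,\dots,e_7$ of $\mathfrak g$ (an adapted basis), with dual basis $e^1,\dots,e^7$, such that $$\varphi=e^{127}+e^{347}+e^{567}+e^{135}-e^{146}-e^{236}-e^{245},\qquad e^{ijk}:=e^i\wedge e^j\wedge e^k.$$ Such a $\varphi$ induces a Euclidean metric and an orientation on $\mathfrak g$ for which the adapted bases are oriented orthonormal bases, and hence a Hodge star operator $\star_\varphi$. Let $d$ be the differential on $\Lambda^*\mathfrak g^*$ given by $$(d\omega)(x_0,\dots,x_k)=\sum_{i<j}(-1)^{i+j}\,\omega([x_i,x_j],x_0,\dots,\widehat{x_i},\dots,\widehat{x_j},\dots,x_k)\qquad(\omega\in\Lambda^k\mathfrak g^*);$$ this is the exterior derivative of left-invariant forms on a corresponding Lie group. The $G_2$-structure $\varphi$ is called cocalibrated if $d\star_\varphi\varphi=0$. Let $\mathfrak g=\mathfrak g_4\oplus\mathfrak g_3$ be a Lie algebra direct sum of a four-dimensional Lie algebra $\mathfrak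 g_4$ and a three-dimensional Lie algebra $\mathfrak g_3$. If $\mathfrak g$ is not solvable, then $\mathfrak g$ admits a cocalibrated $G_2$-structure. -/

import Mathlib

/-- The form `e^{s 0} ∧ ⋯ ∧ e^{s (k-1)}`, where `e^0, …, e^{n-1}` is the basis dual to `b`; its value
on `v` is the determinant of the matrix of the numbers `e^{s i} (v j)`. -/
noncomputable def coframe {V : Type*} [AddCommGroup V] [Module ℝ V] {n k : ℕ}
    (b : Module.Basis (Fin n) ℝ V) (s : Fin k → Fin n) : V [⋀^Fin k]→ₗ[ℝ] ℝ :=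
  (Matrix.detRowAlternating (n := Fin k) (R := ℝ)).compLinearMap
    (LinearMap.pi fun i => b.coord (s i))

/-- The wedge product of a `k`-form and an `l`-form (the sum over `(k, l)`-shuffles, so that
`(α ∧ β) (x, y) = α x * β y - α y * β x` for one-forms). -/
noncomputable def wedge {V : Type*} [AddCommGroup V] [Module ℝ V] {k l : ℕ}
    (α : V [⋀^Fin k]→ₗ[ℝ] ℝ) (β : V [⋀^Fin l]→ₗ[ℝ] ℝ) : V [⋀^Fin (k + l)]→ₗ[ℝ] ℝ :=
  (LinearMap.mul' ℝ ℝ).compAlternatingMap ((α.domCoprod β).domDomCongr finSumFinEquiv)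

/-- The inner product on `k`-forms induced by the Euclidean metric for which `b` is orthonormal,
i.e. the one for which the forms `e^{i_1} ∧ ⋯ ∧ e^{i_k}` with `i_1 < ⋯ < i_k` are orthonormal. -/
noncomputable def formInner {V : Type*} [AddCommGroup V] [Module ℝ V] {n k : ℕ}
    (b : Module.Basis (Fin n) ℝ V) (α β : V [⋀^Fin k]→ₗ[ℝ] ℝ) : ℝ :=
  ∑ s : Fin k ↪o Fin n, α (fun i => b (s i)) * β (fun i => b (s i))

/-- `η` is the Hodge dual of `ω` with respect to the Euclidean metric and the orientation
for which `b` is an oriented orthonormal basis (the metric volume form is then `b.det`):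
`ω ∧ ψ = ⟨η, ψ⟩ vol` for all forms `ψ` of the complementary degree. -/
def IsHodgeDual {V : Type*} [AddCommGroup V] [Module ℝ V] {k l : ℕ}
    (b : Module.Basis (Fin (k + l)) ℝ V)
    (ω : V [⋀^Fin k]→ₗ[ℝ] ℝ) (η : V [⋀^Fin l]→ₗ[ℝ] ℝ) : Prop :=
  ∀ ψ : V [⋀^Fin l]→ₗ[ℝ] ℝ, wedge ω ψ = formInner b η ψ • b.det

/-- `b` is an adapted basis for `φ`:
`φ = e^{127} + e^{347} + e^{567} + e^{135} - e^{146} - e^{236} - e^{245}`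
(the indices are shifted by one below). -/
def IsAdaptedBasis {V : Type*} [AddCommGroup V] [Module ℝ V]
    (φ : V [⋀^Fin 3]→ₗ[ℝ] ℝ) (b : Module.Basis (Fin 7) ℝ V) : Prop :=
  φ = coframe b ![0, 1, 6] + coframe b ![2, 3, 6] + coframe b ![4, 5, 6] + coframe b ![0, 2, 4]
    - coframe b ![0, 3, 5] - coframe b ![1, 2, 5] - coframe b ![1, 3, 4]

/-- A `G₂`-structure on a vector space: a three-form that has an adapted basis. -/
def IsG2Structure {V : Type*} [AddCommGroup V] [Module ℝ V] (φ : V [⋀^Fin 3]→ₗ[ℝ] ℝ) : Prop :=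
  ∃ b : Module.Basis (Fin 7) ℝ V, IsAdaptedBasis φ b

/-- `η` is the Hodge dual `⋆_φ φ` of the `G₂`-structure `φ`, taken with respect to the metric and
the orientation induced by `φ`, for which adapted bases are oriented orthonormal. Any one adapted
basis determines them, since two adapted bases differ by an element of the stabilizer
`G₂ ⊆ SO(7)` of `φ`. -/
def IsG2HodgeDual {V : Type*} [AddCommGroup V] [Module ℝ V]
    (φ : V [⋀^Fin 3]→ₗ[ℝ] ℝ) (η : V [⋀^Fin 4]→ₗ[ℝ] ℝ) : Prop :=
  ∃ b : Module.Basis (Fin 7) ℝ V, IsAdaptedBasis φ b ∧ IsHodgeDual (k := 3) (l := 4) b φ η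

/-- The differential on forms on a Lie algebra `g` (the exterior derivative of left-invariant
forms), as a function of `x_0, …, x_{k+1}`:
`dω (x_0, …, x_{k+1}) = ∑_{i < j} (-1)^{i+j} ω ([x_i, x_j], x_0, …, x̂_i, …, x̂_j, …, x_{k+1})`.
The pair `i ≤ j` in the code stands for the pair `i < j + 1` in this formula, whence the sign. -/
def lieDifferential {g : Type*} [LieRing g] [LieAlgebra ℝ g] {k : ℕ}
    (ω : g [⋀^Fin (k + 1)]→ₗ[ℝ] ℝ) (x : Fin (k + 2) → g) : ℝ :=
  -∑ i : Fin (k + 1), ∑ j ∈ Finset.Ici i, (-1 : ℝ) ^ (i + j : ℕ) *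
    ω (Matrix.vecCons ⁅x i.castSucc, x j.succ⁆ (j.removeNth (i.castSucc.removeNth x)))

/-- A `G₂`-structure `φ` on a Lie algebra is cocalibrated if `d ⋆_φ φ = 0`. -/
def IsCocalibrated {g : Type*} [LieRing g] [LieAlgebra ℝ g] (φ : g [⋀^Fin 3]→ₗ[ℝ] ℝ) : Prop :=
  ∃ η : g [⋀^Fin 4]→ₗ[ℝ] ℝ, IsG2HodgeDual φ η ∧ ∀ x : Fin 5 → g, lieDifferential η x = 0

/-- The Lie algebra `g` admits a cocalibrated `G₂`-structure. -/
def AdmitsCocalibratedG2Structure (g : Type*) [LieRing g] [LieAlgebra ℝ g] : Prop :=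
  ∃ φ : g [⋀^Fin 3]→ₗ[ℝ] ℝ, IsG2Structure φ ∧ IsCocalibrated φ

/-! A nonsolvable algebra has a nonzero perfect ideal, since its derived series stabilizes at a
nonzero term. The image of this ideal in each factor is again a perfect ideal, and a nonzero perfect
ideal has dimension at least three. So either `g₃` is perfect, or `g₄` contains a nonzero perfect
ideal. The latter has dimension three because no four-dimensional Lie algebra is perfect
(`not_isPerfectIdeal_top`), and it has a central complement (`exists_central_complement`). Either
way the algebra is a direct sum of ideals U ⊕ W with dim U = 4 and W perfect of dimension three.

Grade forms by (U-degree, W-degree) and split d = d_U + d_W. For a basis compatible with U ⊕ W, the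
dual four-form η has only parts of type (4,0) and (2,2). Replacing the first four basis vectors by
their sums with vectors of W gives it an arbitrary part of type (3,1), keeps the (2,2) part and
creates no (1,3) part (`exists_starForm`). Brackets on W are encoded by a matrix S, invertible
because W is perfect and symmetric by the Jacobi identity (`exists_structure_matrix`). Hence d_W is
an isomorphism from one-forms to two-forms on W and vanishes on two-forms.

Now dη = 0 is checked type by type (`admitsCocalibratedG2Structure_of_basis`). In type (3,2) it
reads d_W η₃₁ = -d_U η₂₂, which determines η₃₁. In type (4,1) it reads d_U η₃₁ = 0, which follows
since d_W is injective there and d_W d_U η₃₁ = ±d_U² η₂₂ = 0. Type (2,3) vanishes because d_W η₂₂ =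
0 and η₁₃ = 0. No other type fits the dimensions. -/

/-! ### Wedge products, inner products and the Hodge dual of a G₂-form. -/

theorem coframe_apply {V : Type*} [AddCommGroup V] [Module ℝ V] {n k : ℕ}
    (b : Module.Basis (Fin n) ℝ V) (s : Fin k → Fin n) (v : Fin k → V) :
    coframe b s v = Matrix.det (Matrix.of fun i j => b.coord (s j) (v i)) := rfl

/-- A coframe form vanishes on basis vectors whose indices are not among its own. -/
theorem coframe_apply_basis_eq_zero {V : Type*} [AddCommGroup V] [Module ℝ V] {n k : ℕ}
    (b : Module.Basis (Fin n) ℝ V) (s r : Fin k → Fin n) (j : Fin k) (h : ∀ i, r i ≠ s j) :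
    coframe b s (fun i => b (r i)) = 0 := by
  rw [coframe_apply]
  refine Matrix.det_eq_zero_of_column_eq_zero j fun i => ?_
  simp [Finsupp.single_apply, h i]

theorem coframe_apply_basis_self {V : Type*} [AddCommGroup V] [Module ℝ V] {n k : ℕ}
    (b : Module.Basis (Fin n) ℝ V) (s : Fin k → Fin n) (hs : Function.Injective s) :
    coframe b s (fun i => b (s i)) = 1 := by
  rw [coframe_apply]
  convert Matrix.det_one (n := Fin k) (R := ℝ)
  ext i j
  simp [Finsupp.single_apply, Matrix.one_apply, hs.eq_iff]

theorem formInner_coframe {V : Type*} [AddCommGroup V] [Module ℝ V] {n k : ℕ}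
    (b : Module.Basis (Fin n) ℝ V) (t : Fin k → Fin n) (ht : StrictMono t)
    (ψ : V [⋀^Fin k]→ₗ[ℝ] ℝ) : formInner b (coframe b t) ψ = ψ (fun i => b (t i)) := by
  unfold formInner
  rw [Finset.sum_eq_single (OrderEmbedding.ofStrictMono t ht)]
  · simp [coframe_apply_basis_self b t ht.injective]
  · intro s _ hs
    obtain ⟨j, hj⟩ : ∃ j, ∀ i, s i ≠ t j := by
      -- Two strictly increasing tuples with the same range coincide.
      by_contra! hc
      refine hs ?_
      have hr : Set.range t = Set.range s := by
        refine Set.eq_of_subset_of_ncard_le ?_ ?_ (Set.finite_range _)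
        · rintro _ ⟨j, rfl⟩
          obtain ⟨i, hi⟩ := hc j
          exact ⟨i, hi⟩
        · rw [Set.ncard_eq_toFinset_card', Set.ncard_eq_toFinset_card', Set.toFinset_range,
            Set.toFinset_range, Finset.card_image_of_injective _ ht.injective,
            Finset.card_image_of_injective _ s.injective]
      have := (StrictMono.range_inj ht s.strictMono).1 hr
      ext i
      simp [this]
    rw [coframe_apply_basis_eq_zero b t s j hj, zero_mul]
  · simp

theorem formInner_add {V : Type*} [AddCommGroup V] [Module ℝ V] {n k : ℕ}
    (b : Module.Basis (Fin n) ℝ V) (α β ψ : V [⋀^Fin k]→ₗ[ℝ] ℝ) :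
    formInner b (α + β) ψ = formInner b α ψ + formInner b β ψ := by
  simp [formInner, add_mul, Finset.sum_add_distrib]

theorem formInner_sub {V : Type*} [AddCommGroup V] [Module ℝ V] {n k : ℕ}
    (b : Module.Basis (Fin n) ℝ V) (α β ψ : V [⋀^Fin k]→ₗ[ℝ] ℝ) :
    formInner b (α - β) ψ = formInner b α ψ - formInner b β ψ := by
  simp [formInner, sub_mul, Finset.sum_sub_distrib]

theorem wedge_apply {V : Type*} [AddCommGroup V] [Module ℝ V] {k l : ℕ}
    (α : V [⋀^Fin k]→ₗ[ℝ] ℝ) (β : V [⋀^Fin l]→ₗ[ℝ] ℝ) (v : Fin (k + l) → V) :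
    wedge α β v = ∑ σ : Equiv.Perm.ModSumCongr (Fin k) (Fin l),
      LinearMap.mul' ℝ ℝ (AlternatingMap.domCoprod.summand α β σ (v ∘ finSumFinEquiv)) := by
  rw [← map_sum, ← sum_apply]
  rfl

theorem mul'_summand_mk {V : Type*} [AddCommGroup V] [Module ℝ V] {k l : ℕ}
    (α : V [⋀^Fin k]→ₗ[ℝ] ℝ) (β : V [⋀^Fin l]→ₗ[ℝ] ℝ) (σ : Equiv.Perm (Fin k ⊕ Fin l))
    (v : Fin k ⊕ Fin l → V) :
    LinearMap.mul' ℝ ℝ (AlternatingMap.domCoprod.summand α β (Quotient.mk'' σ) v) =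
      (Equiv.Perm.sign σ : ℤ) *
        (α (fun i => v (σ (Sum.inl i))) * β (fun i => v (σ (Sum.inr i)))) := by
  rw [AlternatingMap.domCoprod.summand_mk'']
  rcases Int.units_eq_one_or (Equiv.Perm.sign σ) with h | h <;> simp [h]

theorem wedge_add_left {V : Type*} [AddCommGroup V] [Module ℝ V] {k l : ℕ}
    (α α' : V [⋀^Fin k]→ₗ[ℝ] ℝ) (β : V [⋀^Fin l]→ₗ[ℝ] ℝ) :
    wedge (α + α') β = wedge α β + wedge α' β := by
  ext v
  rw [AlternatingMap.add_apply, wedge_apply, wedge_apply, wedge_apply, ← Finset.sum_add_distrib]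
  refine Finset.sum_congr rfl fun σ _ => ?_
  induction σ using Quotient.inductionOn' with | _ σ
  rw [mul'_summand_mk, mul'_summand_mk, mul'_summand_mk, AlternatingMap.add_apply]
  ring

theorem wedge_sub_left {V : Type*} [AddCommGroup V] [Module ℝ V] {k l : ℕ}
    (α α' : V [⋀^Fin k]→ₗ[ℝ] ℝ) (β : V [⋀^Fin l]→ₗ[ℝ] ℝ) :
    wedge (α - α') β = wedge α β - wedge α' β := by
  rw [eq_sub_iff_add_eq, ← wedge_add_left, sub_add_cancel]

/-- In the sum over shuffle classes, the coframe form vanishes unless the first block of arguments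
carries exactly its own indices. Only the class of `π` survives. -/
theorem wedge_coframe_apply_basis {V : Type*} [AddCommGroup V] [Module ℝ V] {k l : ℕ}
    (b : Module.Basis (Fin (k + l)) ℝ V) (π : Equiv.Perm (Fin (k + l)))
    (ψ : V [⋀^Fin l]→ₗ[ℝ] ℝ) :
    wedge (coframe b (fun i => π (Fin.castAdd l i))) ψ b =
      (Equiv.Perm.sign π : ℤ) * ψ (fun j => b (π (Fin.natAdd k j))) := by
  set σ₀ : Equiv.Perm (Fin k ⊕ Fin l) := finSumFinEquiv.symm.permCongr π with hσ₀
  have hl (i : Fin k) : finSumFinEquiv (σ₀ (Sum.inl i)) = π (Fin.castAdd l i) := by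
    simp [hσ₀]
  have hr (i : Fin l) : finSumFinEquiv (σ₀ (Sum.inr i)) = π (Fin.natAdd k i) := by
    simp [hσ₀]
  rw [wedge_apply]
  refine (Fintype.sum_eq_single (Quotient.mk'' σ₀ : Equiv.Perm.ModSumCongr (Fin k) (Fin l))
    ?_).trans ?_
  · intro q hq
    induction q using Quotient.inductionOn' with | _ σ
    obtain ⟨j, hj⟩ : ∃ j, ∀ i, σ (Sum.inl i) ≠ σ₀ (Sum.inl j) := by
      by_contra! hc
      refine hq (Quotient.sound' ?_)
      rw [QuotientGroup.leftRel_apply]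
      have hinv : σ⁻¹ * σ₀ ∈ (Equiv.Perm.sumCongrHom (Fin k) (Fin l)).range := by
        refine Equiv.Perm.mem_sumCongrHom_range_of_perm_mapsTo_inl ?_
        rintro _ ⟨j, rfl⟩
        obtain ⟨i, hi⟩ := hc j
        exact ⟨i, by simp [← hi]⟩
      simpa using hinv
    rw [mul'_summand_mk]
    simp only [Function.comp_apply]
    rw [coframe_apply_basis_eq_zero b _ (fun i => finSumFinEquiv (σ (Sum.inl i))) j ?_]
    · simp
    · intro i h
      rw [← hl] at h
      exact hj i (finSumFinEquiv.injective h)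
  · rw [mul'_summand_mk]
    simp only [Function.comp_apply, hl, hr]
    rw [coframe_apply_basis_self b _ fun i j h => by simpa using h, one_mul, hσ₀,
      Equiv.Perm.sign_permCongr]

/-- The four-form that is Hodge dual to the `G₂`-form with adapted basis `b`. -/
noncomputable def starForm {V : Type*} [AddCommGroup V] [Module ℝ V]
    (b : Module.Basis (Fin 7) ℝ V) : V [⋀^Fin 4]→ₗ[ℝ] ℝ :=
  coframe b ![2, 3, 4, 5] + coframe b ![0, 1, 4, 5] + coframe b ![0, 1, 2, 3]
    - coframe b ![1, 3, 5, 6] + coframe b ![1, 2, 4, 6] + coframe b ![0, 3, 4, 6]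
    + coframe b ![0, 2, 5, 6]

theorem wedge_coframe_three_apply_basis {V : Type*} [AddCommGroup V] [Module ℝ V]
    (b : Module.Basis (Fin (3 + 4)) ℝ V) (ψ : V [⋀^Fin 4]→ₗ[ℝ] ℝ) (s : Fin 3 → Fin (3 + 4))
    (t : Fin 4 → Fin (3 + 4)) (π : Equiv.Perm (Fin (3 + 4)))
    (hs : s = fun i => π (Fin.castAdd 4 i)) (ht : t = fun i => π (Fin.natAdd 3 i)) :
    wedge (coframe b s) ψ b = (Equiv.Perm.sign π : ℤ) * ψ (fun j => b (t j)) := by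
  subst hs ht
  exact wedge_coframe_apply_basis b π ψ

theorem isHodgeDual_starForm {V : Type*} [AddCommGroup V] [Module ℝ V]
    {φ : V [⋀^Fin 3]→ₗ[ℝ] ℝ} {b : Module.Basis (Fin 7) ℝ V} (h : IsAdaptedBasis φ b) :
    IsHodgeDual (k := 3) (l := 4) b φ (starForm b) := by
  intro ψ
  -- Forms of top degree are multiples of `b.det`, so evaluation on `b` suffices.
  rw [AlternatingMap.eq_smul_basis_det b (wedge φ ψ)]
  refine congrArg (fun c : ℝ => c • b.det) ?_
  rw [IsAdaptedBasis] at h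
  subst h
  simp only [wedge_add_left, wedge_sub_left, AlternatingMap.add_apply, AlternatingMap.sub_apply]
  simp only [starForm, formInner_add, formInner_sub]
  rw [formInner_coframe b _ (by decide), formInner_coframe b _ (by decide),
    formInner_coframe b _ (by decide), formInner_coframe b _ (by decide),
    formInner_coframe b _ (by decide), formInner_coframe b _ (by decide),
    formInner_coframe b _ (by decide)]
  -- Each permutation lists a triple of the G₂-form followed by its complement; the second vector is
  -- its inverse. Its sign times the coefficient of the triple is the coefficient of the complement
  -- in `starForm`.
  rw [wedge_coframe_three_apply_basis b ψ ![0, 1, 6] ![2, 3, 4, 5]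
    ⟨![0, 1, 6, 2, 3, 4, 5], ![0, 1, 3, 4, 5, 6, 2], by decide, by decide⟩ (by decide) (by decide),
    show Equiv.Perm.sign (⟨![0, 1, 6, 2, 3, 4, 5], ![0, 1, 3, 4, 5, 6, 2], by decide, by decide⟩ :
      Equiv.Perm (Fin (3 + 4))) = 1 by decide]
  rw [wedge_coframe_three_apply_basis b ψ ![2, 3, 6] ![0, 1, 4, 5]
    ⟨![2, 3, 6, 0, 1, 4, 5], ![3, 4, 0, 1, 5, 6, 2], by decide, by decide⟩ (by decide) (by decide),
    show Equiv.Perm.sign (⟨![2, 3, 6, 0, 1, 4, 5], ![3, 4, 0, 1, 5, 6, 2], by decide, by decide⟩ :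
      Equiv.Perm (Fin (3 + 4))) = 1 by decide]
  rw [wedge_coframe_three_apply_basis b ψ ![4, 5, 6] ![0, 1, 2, 3]
    ⟨![4, 5, 6, 0, 1, 2, 3], ![3, 4, 5, 6, 0, 1, 2], by decide, by decide⟩ (by decide) (by decide),
    show Equiv.Perm.sign (⟨![4, 5, 6, 0, 1, 2, 3], ![3, 4, 5, 6, 0, 1, 2], by decide, by decide⟩ :
      Equiv.Perm (Fin (3 + 4))) = 1 by decide]
  rw [wedge_coframe_three_apply_basis b ψ ![0, 2, 4] ![1, 3, 5, 6]
    ⟨![0, 2, 4, 1, 3, 5, 6], ![0, 3, 1, 4, 2, 5, 6], by decide, by decide⟩ (by decide) (by decide),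
    show Equiv.Perm.sign (⟨![0, 2, 4, 1, 3, 5, 6], ![0, 3, 1, 4, 2, 5, 6], by decide, by decide⟩ :
      Equiv.Perm (Fin (3 + 4))) = -1 by decide]
  rw [wedge_coframe_three_apply_basis b ψ ![0, 3, 5] ![1, 2, 4, 6]
    ⟨![0, 3, 5, 1, 2, 4, 6], ![0, 3, 4, 1, 5, 2, 6], by decide, by decide⟩ (by decide) (by decide),
    show Equiv.Perm.sign (⟨![0, 3, 5, 1, 2, 4, 6], ![0, 3, 4, 1, 5, 2, 6], by decide, by decide⟩ :
      Equiv.Perm (Fin (3 + 4))) = -1 by decide]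
  rw [wedge_coframe_three_apply_basis b ψ ![1, 2, 5] ![0, 3, 4, 6]
    ⟨![1, 2, 5, 0, 3, 4, 6], ![3, 0, 1, 4, 5, 2, 6], by decide, by decide⟩ (by decide) (by decide),
    show Equiv.Perm.sign (⟨![1, 2, 5, 0, 3, 4, 6], ![3, 0, 1, 4, 5, 2, 6], by decide, by decide⟩ :
      Equiv.Perm (Fin (3 + 4))) = -1 by decide]
  rw [wedge_coframe_three_apply_basis b ψ ![1, 3, 4] ![0, 2, 5, 6]
    ⟨![1, 3, 4, 0, 2, 5, 6], ![3, 0, 4, 1, 2, 5, 6], by decide, by decide⟩ (by decide) (by decide),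
    show Equiv.Perm.sign (⟨![1, 3, 4, 0, 2, 5, 6], ![3, 0, 4, 1, 2, 5, 6], by decide, by decide⟩ :
      Equiv.Perm (Fin (3 + 4))) = -1 by decide]
  simp
  ring

/-- A closed four-form `starForm b` gives a cocalibrated `G₂`-structure. -/
theorem admitsCocalibratedG2Structure_of_starForm {g : Type*} [LieRing g] [LieAlgebra ℝ g]
    (b : Module.Basis (Fin 7) ℝ g) (h : ∀ x : Fin 5 → g, lieDifferential (starForm b) x = 0) :
    AdmitsCocalibratedG2Structure g :=
  ⟨_, ⟨b, rfl⟩, starForm b, ⟨b, rfl, isHodgeDual_starForm rfl⟩, h⟩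

/-! ### The Lie algebra differential as an alternating map. -/

/-- The differential of a form on a Lie algebra as an alternating map. -/
noncomputable def lieDifferentialForm {g : Type*} [LieRing g] [LieAlgebra ℝ g] {k : ℕ}
    (ω : g [⋀^Fin (k + 1)]→ₗ[ℝ] ℝ) : g [⋀^Fin (k + 2)]→ₗ[ℝ] ℝ :=
  (-(1 / 2) : ℝ) • AlternatingMap.alternatizeUncurryFin
    (AlternatingMap.alternatizeUncurryFinLM ∘ₗ
      (LieModule.toEnd ℝ g g : g →ₗ[ℝ] g →ₗ[ℝ] g).compr₂ ω.curryLeft)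

theorem lieDifferentialForm_apply {g : Type*} [LieRing g] [LieAlgebra ℝ g] {k : ℕ}
    (ω : g [⋀^Fin (k + 1)]→ₗ[ℝ] ℝ) (x : Fin (k + 2) → g) :
    lieDifferentialForm ω x = lieDifferential ω x := by
  rw [lieDifferentialForm, AlternatingMap.smul_apply,
    AlternatingMap.alternatizeUncurryFin_alternatizeUncurryFinLM_comp_apply, lieDifferential,
    smul_eq_mul, neg_mul, Finset.mul_sum]
  congr 1
  refine Finset.sum_congr rfl fun i _ => ?_
  rw [Finset.mul_sum]
  refine Finset.sum_congr rfl fun j _ => ?_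
  -- The double alternatization contains both orders of each pair; by antisymmetry of the bracket
  -- they contribute equally, which the factor 1/2 compensates.
  have hskew : ⁅x j.succ, x i.castSucc⁆ = (-1 : ℝ) • ⁅x i.castSucc, x j.succ⁆ := by
    rw [neg_one_smul, lie_skew]
  simp only [LinearMap.compr₂_apply, LieHom.coe_toLinearMap, LieModule.toEnd_apply_apply,
    AlternatingMap.curryLeft_apply_apply, zsmul_eq_mul, Int.cast_pow, Int.cast_neg, Int.cast_one]
  rw [hskew, AlternatingMap.map_vecCons_smul, smul_eq_mul]
  ring

/-- An alternating map vanishes if it does so on the increasing tuples of basis vectors. -/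
theorem eq_zero_of_strictMono_basis {V : Type*} [AddCommGroup V] [Module ℝ V] {n k : ℕ}
    (b : Module.Basis (Fin n) ℝ V) (f : V [⋀^Fin k]→ₗ[ℝ] ℝ)
    (h : ∀ r : Fin k → Fin n, StrictMono r → f (fun i => b (r i)) = 0) : f = 0 := by
  refine Module.Basis.ext_alternating b fun r hr => ?_
  have hs : StrictMono (r ∘ Tuple.sort r) :=
    (Tuple.monotone_sort r).strictMono_of_injective (hr.comp (Tuple.sort r).injective)
  have := f.map_perm (fun i => b (r i)) (Tuple.sort r)
  have h0 := h _ hs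
  have h1 : ((fun i => b (r i)) ∘ Tuple.sort r) = fun i => b ((r ∘ Tuple.sort r) i) := rfl
  rw [h1, h0] at this
  rcases Int.units_eq_one_or (Equiv.Perm.sign (Tuple.sort r)) with hh | hh <;>
    simpa [hh, eq_comm] using this

theorem lieDifferential_five {g : Type*} [LieRing g] [LieAlgebra ℝ g]
    (η : g [⋀^Fin 4]→ₗ[ℝ] ℝ) (a b c d e : g) :
    lieDifferential η ![a, b, c, d, e] =
      -η ![⁅a, b⁆, c, d, e] + η ![⁅a, c⁆, b, d, e] - η ![⁅a, d⁆, b, c, e] + η ![⁅a, e⁆, b, c, d]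
      - η ![⁅b, c⁆, a, d, e] + η ![⁅b, d⁆, a, c, e] - η ![⁅b, e⁆, a, c, d]
      - η ![⁅c, d⁆, a, b, e] + η ![⁅c, e⁆, a, b, d] - η ![⁅d, e⁆, a, b, c] := by
  have h0 : Finset.Ici (0 : Fin 4) = {0, 1, 2, 3} := by decide
  have h1 : Finset.Ici (1 : Fin 4) = {1, 2, 3} := by decide
  have h2 : Finset.Ici (2 : Fin 4) = {2, 3} := by decide
  have h3 : Finset.Ici (3 : Fin 4) = {3} := by decide
  have key (i j : Fin 4) (y : g) (z : Fin 3 → g)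
      (hz : j.removeNth (i.castSucc.removeNth ![a, b, c, d, e]) = z) :
      η (Matrix.vecCons y (j.removeNth (i.castSucc.removeNth ![a, b, c, d, e]))) =
        η (Matrix.vecCons y z) := by rw [hz]
  unfold lieDifferential
  rw [Fin.sum_univ_four, h0, h1, h2, h3]
  simp only [Finset.sum_insert (show (0 : Fin 4) ∉ ({1, 2, 3} : Finset (Fin 4)) by decide),
    Finset.sum_insert (show (1 : Fin 4) ∉ ({2, 3} : Finset (Fin 4)) by decide),
    Finset.sum_insert (show (2 : Fin 4) ∉ ({3} : Finset (Fin 4)) by decide),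
    Finset.sum_singleton]
  rw [key 0 0 _ ![c, d, e] (by ext i; fin_cases i <;> rfl),
    key 0 1 _ ![b, d, e] (by ext i; fin_cases i <;> rfl),
    key 0 2 _ ![b, c, e] (by ext i; fin_cases i <;> rfl),
    key 0 3 _ ![b, c, d] (by ext i; fin_cases i <;> rfl),
    key 1 1 _ ![a, d, e] (by ext i; fin_cases i <;> rfl),
    key 1 2 _ ![a, c, e] (by ext i; fin_cases i <;> rfl),
    key 1 3 _ ![a, c, d] (by ext i; fin_cases i <;> rfl),
    key 2 2 _ ![a, b, e] (by ext i; fin_cases i <;> rfl),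
    key 2 3 _ ![a, b, d] (by ext i; fin_cases i <;> rfl),
    key 3 3 _ ![a, b, c] (by ext i; fin_cases i <;> rfl)]
  have c0 : ![a, b, c, d, e] (Fin.castSucc (0 : Fin 4)) = a := rfl
  have c1 : ![a, b, c, d, e] (Fin.castSucc (1 : Fin 4)) = b := rfl
  have c2 : ![a, b, c, d, e] (Fin.castSucc (2 : Fin 4)) = c := rfl
  have c3 : ![a, b, c, d, e] (Fin.castSucc (3 : Fin 4)) = d := rfl
  have s0 : ![a, b, c, d, e] (Fin.succ (0 : Fin 4)) = b := rfl
  have s1 : ![a, b, c, d, e] (Fin.succ (1 : Fin 4)) = c := rfl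
  have s2 : ![a, b, c, d, e] (Fin.succ (2 : Fin 4)) = d := rfl
  have s3 : ![a, b, c, d, e] (Fin.succ (3 : Fin 4)) = e := rfl
  simp only [c0, c1, c2, c3, s0, s1, s2, s3]
  norm_num
  ring

/-! ### Multilinear calculus for four-forms. -/

section FourForm

variable {V : Type*} [AddCommGroup V] [Module ℝ V] (η : V [⋀^Fin 4]→ₗ[ℝ] ℝ)

theorem four_swap_01 (x y z v : V) : η ![y, x, z, v] = -η ![x, y, z, v] := by
  rw [← η.map_swap ![x, y, z, v] (show (0 : Fin 4) ≠ 1 by decide)]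
  congr 1; ext i; fin_cases i <;> rfl

theorem four_swap_12 (x y z v : V) : η ![x, z, y, v] = -η ![x, y, z, v] := by
  rw [← η.map_swap ![x, y, z, v] (show (1 : Fin 4) ≠ 2 by decide)]
  congr 1; ext i; fin_cases i <;> rfl

theorem four_swap_23 (x y z v : V) : η ![x, y, v, z] = -η ![x, y, z, v] := by
  rw [← η.map_swap ![x, y, z, v] (show (2 : Fin 4) ≠ 3 by decide)]
  congr 1; ext i; fin_cases i <;> rfl

theorem four_add (x x' y z v : V) :
    η ![x + x', y, z, v] = η ![x, y, z, v] + η ![x', y, z, v] :=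
  η.map_vecCons_add _ _ _

theorem four_smul (c : ℝ) (x y z v : V) : η ![c • x, y, z, v] = c * η ![x, y, z, v] :=
  η.map_vecCons_smul _ _ _

theorem four_neg (x y z v : V) : η ![-x, y, z, v] = -η ![x, y, z, v] := by
  rw [← neg_one_smul ℝ x, four_smul, neg_one_mul]

theorem four_zero (y z v : V) : η ![0, y, z, v] = 0 := by
  simpa using four_smul η 0 0 y z v

theorem four_sum {ι : Type*} [Fintype ι] (c : ι → ℝ) (x : ι → V) (y z v : V) :
    η ![∑ i, c i • x i, y, z, v] = ∑ i, c i * η ![x i, y, z, v] := by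
  let ℓ : V →ₗ[ℝ] ℝ :=
    { toFun := fun s => η ![s, y, z, v]
      map_add' := fun s s' => four_add η s s' y z v
      map_smul' := fun c s => four_smul η c s y z v }
  change ℓ (∑ i, c i • x i) = ∑ i, c i * ℓ (x i)
  simp only [map_sum, map_smul, smul_eq_mul]

end FourForm

/-! ### Values of the dual four-form on basis vectors. -/

/-- Laplace expansion along the first two rows. The same polynomial over ℤ defines `coframeTable`,
so that values of `starForm` on basis vectors become decidable. -/
theorem det_fin_four_laplace {R : Type*} [CommRing R] (A : Matrix (Fin 4) (Fin 4) R) :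
    A.det =
      (A 0 0 * A 1 1 - A 0 1 * A 1 0) * (A 2 2 * A 3 3 - A 2 3 * A 3 2)
      - (A 0 0 * A 1 2 - A 0 2 * A 1 0) * (A 2 1 * A 3 3 - A 2 3 * A 3 1)
      + (A 0 0 * A 1 3 - A 0 3 * A 1 0) * (A 2 1 * A 3 2 - A 2 2 * A 3 1)
      + (A 0 1 * A 1 2 - A 0 2 * A 1 1) * (A 2 0 * A 3 3 - A 2 3 * A 3 0)
      - (A 0 1 * A 1 3 - A 0 3 * A 1 1) * (A 2 0 * A 3 2 - A 2 2 * A 3 0)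
      + (A 0 2 * A 1 3 - A 0 3 * A 1 2) * (A 2 0 * A 3 1 - A 2 1 * A 3 0) := by
  rw [Matrix.det_succ_row_zero, Fin.sum_univ_four]
  simp [Matrix.det_fin_three, Fin.succAbove]
  ring

/-- The values of a coframe four-form on basis vectors. -/
def coframeTable (s r : Fin 4 → Fin 7) : ℤ :=
  let A : Fin 4 → Fin 4 → ℤ := fun i j => if r i = s j then 1 else 0
  (A 0 0 * A 1 1 - A 0 1 * A 1 0) * (A 2 2 * A 3 3 - A 2 3 * A 3 2)
    - (A 0 0 * A 1 2 - A 0 2 * A 1 0) * (A 2 1 * A 3 3 - A 2 3 * A 3 1)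
    + (A 0 0 * A 1 3 - A 0 3 * A 1 0) * (A 2 1 * A 3 2 - A 2 2 * A 3 1)
    + (A 0 1 * A 1 2 - A 0 2 * A 1 1) * (A 2 0 * A 3 3 - A 2 3 * A 3 0)
    - (A 0 1 * A 1 3 - A 0 3 * A 1 1) * (A 2 0 * A 3 2 - A 2 2 * A 3 0)
    + (A 0 2 * A 1 3 - A 0 3 * A 1 2) * (A 2 0 * A 3 1 - A 2 1 * A 3 0)

/-- The values of `starForm` on basis vectors. -/
def starTable (r : Fin 4 → Fin 7) : ℤ :=
  coframeTable ![2, 3, 4, 5] r + coframeTable ![0, 1, 4, 5] r + coframeTable ![0, 1, 2, 3] r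
    - coframeTable ![1, 3, 5, 6] r + coframeTable ![1, 2, 4, 6] r + coframeTable ![0, 3, 4, 6] r
    + coframeTable ![0, 2, 5, 6] r

theorem starForm_apply_basis {V : Type*} [AddCommGroup V] [Module ℝ V]
    (b : Module.Basis (Fin 7) ℝ V) (i j k l : Fin 7) :
    starForm b ![b i, b j, b k, b l] = starTable ![i, j, k, l] := by
  have hr : ![b i, b j, b k, b l] = fun m => b (![i, j, k, l] m) := by
    ext m; fin_cases m <;> rfl
  rw [hr]
  generalize ![i, j, k, l] = r
  have h (s : Fin 4 → Fin 7) : coframe b s (fun i => b (r i)) = coframeTable s r := by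
    rw [coframe_apply, coframeTable, det_fin_four_laplace]
    simp [Finsupp.single_apply]
  simp only [starForm, starTable, AlternatingMap.add_apply, AlternatingMap.sub_apply, h]
  push_cast
  rfl

theorem starTable_one_three : ∀ (a b c : Fin 3) (i : Fin 4),
    starTable ![i.castAdd 3, a.natAdd 4, b.natAdd 4, c.natAdd 4] = 0 := by
  decide +kernel

theorem starTable_zero_four : ∀ a b c d : Fin 3,
    starTable ![a.natAdd 4, b.natAdd 4, c.natAdd 4, d.natAdd 4] = 0 := by
  decide +kernel

theorem starTable_three_one : ∀ (a : Fin 3) (i j k : Fin 4),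
    starTable ![a.natAdd 4, i.castAdd 3, j.castAdd 3, k.castAdd 3] = 0 := by
  decide +kernel

/-- The values of `starForm` on two of the last three and two of the first four basis vectors. -/
def starTableTwoTwo : Fin 3 → Fin 3 → Fin 4 → Fin 4 → ℤ :=
  ![![![![0, 0, 0, 0], ![0, 0, 0, 0], ![0, 0, 0, 0], ![0, 0, 0, 0]],
      ![![0, 1, 0, 0], ![-1, 0, 0, 0], ![0, 0, 0, 1], ![0, 0, -1, 0]],
      ![![0, 0, 0, 1], ![0, 0, 1, 0], ![0, -1, 0, 0], ![-1, 0, 0, 0]]],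
    ![![![0, -1, 0, 0], ![1, 0, 0, 0], ![0, 0, 0, -1], ![0, 0, 1, 0]],
      ![![0, 0, 0, 0], ![0, 0, 0, 0], ![0, 0, 0, 0], ![0, 0, 0, 0]],
      ![![0, 0, 1, 0], ![0, 0, 0, -1], ![-1, 0, 0, 0], ![0, 1, 0, 0]]],
    ![![![0, 0, 0, -1], ![0, 0, -1, 0], ![0, 1, 0, 0], ![1, 0, 0, 0]],
      ![![0, 0, -1, 0], ![0, 0, 0, 1], ![1, 0, 0, 0], ![0, -1, 0, 0]],
      ![![0, 0, 0, 0], ![0, 0, 0, 0], ![0, 0, 0, 0], ![0, 0, 0, 0]]]]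

theorem starTable_two_two : ∀ (l k : Fin 3) (y z : Fin 4),
    starTable ![l.natAdd 4, k.natAdd 4, y.castAdd 3, z.castAdd 3] = starTableTwoTwo l k y z := by
  decide +kernel

/-! ### Shears and the prescription of the (3,1) part. -/

/-- The coordinates of the change of basis that gives the components of `starForm` on one of the
last three and three of the first four basis vectors prescribed values. -/
noncomputable def shearCoeff (T : Fin 3 → Fin 4 → ℝ) : Fin 4 → Fin 3 → ℝ :=
  ![![(T 0 0 - T 1 1 - T 2 3) / 2, (T 0 1 + T 1 0 + T 2 2) / 2, (T 0 3 - T 1 2 + T 2 0) / 2],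
    ![(-T 0 1 - T 1 0 + T 2 2) / 2, (T 0 0 - T 1 1 + T 2 3) / 2, (-T 0 2 - T 1 3 - T 2 1) / 2],
    ![(T 0 2 - T 1 3 + T 2 1) / 2, (T 0 3 + T 1 2 - T 2 0) / 2, (-T 0 1 + T 1 0 + T 2 2) / 2],
    ![(-T 0 3 - T 1 2 - T 2 0) / 2, (T 0 2 - T 1 3 - T 2 1) / 2, (T 0 0 + T 1 1 - T 2 3) / 2]]

/-- A shear is given by three one-forms a_k on U, and it changes the (3,1) part by the wedge
products of the a_k with the two-forms `starTableTwoTwo l k`. Up to sign, these are the triple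
e⁰¹+e²³, e⁰²-e¹³, e⁰³+e¹². This gives twelve linear equations in twelve unknowns, and `shearCoeff`
is an explicit solution. -/
theorem shearCoeff_spec (T : Fin 3 → Fin 4 → ℝ) (l : Fin 3) (m : Fin 4) :
    ∑ k, shearCoeff T (m.succAbove 0) k *
        starTableTwoTwo l k (m.succAbove 1) (m.succAbove 2) -
      ∑ k, shearCoeff T (m.succAbove 1) k *
        starTableTwoTwo l k (m.succAbove 0) (m.succAbove 2) +
      ∑ k, shearCoeff T (m.succAbove 2) k *
        starTableTwoTwo l k (m.succAbove 0) (m.succAbove 1) = T l m := by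
  simp only [Fin.sum_univ_three]
  fin_cases l <;> fin_cases m <;>
    simp [shearCoeff, starTableTwoTwo, Fin.succAbove] <;> ring

section FourForm

variable {V : Type*} [AddCommGroup V] [Module ℝ V] (η : V [⋀^Fin 4]→ₗ[ℝ] ℝ)

theorem four_rotate (x y z v : V) : η ![z, x, y, v] = η ![x, y, z, v] := by
  rw [four_swap_01, four_swap_12, neg_neg]

theorem four_move_last (x y z v : V) : η ![x, y, z, v] = -η ![v, x, y, z] := by
  rw [four_rotate η x y v z, four_swap_23 η x y z v, neg_neg]

theorem four_add_sum_one {ι : Type*} [Fintype ι] (c : ι → ℝ) (x : ι → V) (w p q r : V) :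
    η ![w, p + ∑ i, c i • x i, q, r] = η ![w, p, q, r] + ∑ i, c i * η ![w, x i, q, r] := by
  simp only [four_swap_01 η _ w, four_add, four_sum, mul_neg, Finset.sum_neg_distrib]
  ring

theorem four_add_sum_two {ι : Type*} [Fintype ι] (c : ι → ℝ) (x : ι → V) (w p q r : V) :
    η ![w, p, q + ∑ i, c i • x i, r] = η ![w, p, q, r] + ∑ i, c i * η ![w, p, x i, r] := by
  rw [four_swap_12, four_add_sum_one, four_swap_12, neg_add, neg_neg, ← Finset.sum_neg_distrib]
  congr 1
  refine Finset.sum_congr rfl fun i _ => ?_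
  rw [four_swap_12, mul_neg, neg_neg]

theorem four_add_sum_three {ι : Type*} [Fintype ι] (c : ι → ℝ) (x : ι → V) (w p q r : V) :
    η ![w, p, q, r + ∑ i, c i • x i] = η ![w, p, q, r] + ∑ i, c i * η ![w, p, q, x i] := by
  rw [four_swap_23, four_add_sum_two, four_swap_23, neg_add, neg_neg, ← Finset.sum_neg_distrib]
  congr 1
  refine Finset.sum_congr rfl fun i _ => ?_
  rw [four_swap_23, mul_neg, neg_neg]

end FourForm

section Shear

variable {V : Type*} [AddCommGroup V] [Module ℝ V]

/-- Adding combinations of the last three basis vectors to the first four gives a basis. -/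
theorem exists_shear_basis (e : Module.Basis (Fin 7) ℝ V) (a : Fin 4 → Fin 3 → ℝ) :
    ∃ b : Module.Basis (Fin 7) ℝ V, (∀ l : Fin 3, b (l.natAdd 4) = e (l.natAdd 4)) ∧
      ∀ i : Fin 4, e (i.castAdd 3) = b (i.castAdd 3) + ∑ l, a i l • b (Fin.natAdd 4 l) := by
  let N : V →ₗ[ℝ] V := e.constr ℝ
    (Fin.append (fun i : Fin 4 => ∑ l, a i l • e (Fin.natAdd 4 l)) (fun _ : Fin 3 => (0 : V)))
  have hw (l : Fin 3) : N (e (l.natAdd 4)) = 0 := by simp [N]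
  have hu (i : Fin 4) : N (e (i.castAdd 3)) = ∑ l, a i l • e (Fin.natAdd 4 l) := by simp [N]
  have hNN : N ∘ₗ N = 0 := by
    refine e.ext fun i => ?_
    refine Fin.addCases (m := 4) (n := 3) (fun i => ?_) (fun i => ?_) i
    · simp only [LinearMap.comp_apply, hu, map_sum, map_smul, hw]
      simp
    · simp only [LinearMap.comp_apply, hw]
      simp
  -- Since N² = 0, the maps id - N and id + N are inverse to each other.
  let f : V ≃ₗ[ℝ] V := LinearEquiv.ofLinearMap (LinearMap.id - N) (LinearMap.id + N)
    (by rw [LinearMap.sub_comp, LinearMap.comp_add, LinearMap.comp_add, hNN]; simp)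
    (by rw [LinearMap.add_comp, LinearMap.comp_sub, LinearMap.comp_sub, hNN]; simp)
  have hf (x : V) : f x = x - N x := rfl
  refine ⟨e.map f, fun l => ?_, fun i => ?_⟩
  · rw [Module.Basis.map_apply, hf, hw, sub_zero]
  · simp only [Module.Basis.map_apply, hf, hw, hu, sub_zero]
    abel

/-- The components of `starForm` of type `(3, 1)` can be prescribed by a change of basis which
leaves those of type `(1, 3)` and `(2, 2)` unchanged. -/
theorem exists_starForm (e : Module.Basis (Fin 7) ℝ V) (T : Fin 3 → Fin 4 → ℝ) :
    ∃ b : Module.Basis (Fin 7) ℝ V,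
      (∀ (i : Fin 4) (j k l : Fin 3),
        starForm b ![e (i.castAdd 3), e (j.natAdd 4), e (k.natAdd 4), e (l.natAdd 4)] = 0) ∧
      (∀ (i j : Fin 4) (k l : Fin 3),
        starForm b ![e (i.castAdd 3), e (k.natAdd 4), e (l.natAdd 4), e (j.castAdd 3)] =
          starForm e ![e (i.castAdd 3), e (k.natAdd 4), e (l.natAdd 4), e (j.castAdd 3)]) ∧
      ∀ (l : Fin 3) (m : Fin 4),
        starForm b ![e (l.natAdd 4), e ((m.succAbove 0).castAdd 3),
          e ((m.succAbove 1).castAdd 3), e ((m.succAbove 2).castAdd 3)] = T l m := by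
  obtain ⟨b, hw, hu⟩ := exists_shear_basis e (shearCoeff T)
  have h13 (i : Fin 4) (j k l : Fin 3) :
      starForm b ![e (i.castAdd 3), e (j.natAdd 4), e (k.natAdd 4), e (l.natAdd 4)] = 0 := by
    rw [hu, four_add, four_sum, ← hw, ← hw, ← hw]
    simp only [starForm_apply_basis, starTable_one_three, starTable_zero_four]
    simp
  have h31b (w x y : Fin 3) (j : Fin 4) : starForm b
      ![e (w.natAdd 4), e (x.natAdd 4), b (y.natAdd 4), b (j.castAdd 3)] = 0 := by
    rw [four_move_last, ← hw w, ← hw x, starForm_apply_basis, starTable_one_three]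
    simp
  have h31e (w x y : Fin 3) (j : Fin 4) : starForm b
      ![e (w.natAdd 4), e (x.natAdd 4), b (y.natAdd 4), e (j.castAdd 3)] = 0 := by
    rw [four_move_last, hw, h13, neg_zero]
  -- The (2,2) values are the same with old or new vectors in the U-slots: the difference involves
  -- only components with at least three arguments in W, and these vanish.
  have hbb (k l : Fin 3) (i j : Fin 4) :
      starForm b ![e (k.natAdd 4), e (l.natAdd 4), b (i.castAdd 3), b (j.castAdd 3)] =
        starTableTwoTwo k l i j := by
    rw [← starTable_two_two, ← starForm_apply_basis b, hw, hw]
  have hbe (k l : Fin 3) (i j : Fin 4) :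
      starForm b ![e (k.natAdd 4), e (l.natAdd 4), b (i.castAdd 3), e (j.castAdd 3)] =
        starTableTwoTwo k l i j := by
    rw [hu j, four_add_sum_three, hbb]
    have h (s : Fin 3) : starForm b ![e (k.natAdd 4), e (l.natAdd 4), b (i.castAdd 3),
        b (Fin.natAdd 4 s)] = 0 := by
      rw [four_swap_23, h31b, neg_zero]
    simp only [h]
    simp
  have hee (k l : Fin 3) (i j : Fin 4) :
      starForm b ![e (k.natAdd 4), e (l.natAdd 4), e (i.castAdd 3), e (j.castAdd 3)] =
        starTableTwoTwo k l i j := by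
    rw [hu i, four_add_sum_two, hbe]
    simp only [h31e]
    simp
  refine ⟨b, h13, fun i j k l => ?_, fun l m => ?_⟩
  · rw [← four_rotate (starForm b) _ _ _ _, ← four_rotate (starForm b) _ _ _ _]
    rw [← four_rotate (starForm e) _ _ _ _, ← four_rotate (starForm e) _ _ _ _]
    rw [hee, starForm_apply_basis, starTable_two_two]
  · rw [← shearCoeff_spec T l m]
    generalize m.succAbove 0 = x
    generalize m.succAbove 1 = y
    generalize m.succAbove 2 = z
    have s1 (p q : V) : starForm b ![e (l.natAdd 4), e (x.castAdd 3), p, q] =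
        starForm b ![e (l.natAdd 4), b (x.castAdd 3), p, q] + ∑ k, shearCoeff T x k *
          starForm b ![e (l.natAdd 4), e (Fin.natAdd 4 k), p, q] := by
      rw [hu, four_add_sum_one]
      simp only [hw]
    have s2 (p q : V) : starForm b ![e (l.natAdd 4), p, e (y.castAdd 3), q] =
        starForm b ![e (l.natAdd 4), p, b (y.castAdd 3), q] + ∑ k, shearCoeff T y k *
          starForm b ![e (l.natAdd 4), p, e (Fin.natAdd 4 k), q] := by
      rw [hu, four_add_sum_two]
      simp only [hw]
    have s3 (p q : V) : starForm b ![e (l.natAdd 4), p, q, e (z.castAdd 3)] =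
        starForm b ![e (l.natAdd 4), p, q, b (z.castAdd 3)] + ∑ k, shearCoeff T z k *
          starForm b ![e (l.natAdd 4), p, q, e (Fin.natAdd 4 k)] := by
      rw [hu, four_add_sum_three]
      simp only [hw]
    have h2 (k : Fin 3) : starForm b ![e (l.natAdd 4), b (x.castAdd 3), e (k.natAdd 4),
        e (z.castAdd 3)] = -starTableTwoTwo l k x z := by
      rw [four_swap_12, hbe]
    have h3 (k : Fin 3) : starForm b ![e (l.natAdd 4), b (x.castAdd 3), b (y.castAdd 3),
        e (k.natAdd 4)] = starTableTwoTwo l k x y := by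
      rw [four_swap_23, four_swap_12, neg_neg, hbb]
    -- The U-slots are expanded one at a time. The term without a shear is a (3,1) value in the
    -- basis `b`, hence zero; the other three sums have one vector of W inserted, the middle one
    -- with a sign from moving it.
    rw [s1, s2, s3]
    simp only [hee, h2, h3]
    rw [← hw l, starForm_apply_basis, starTable_three_one]
    simp only [mul_neg, Finset.sum_neg_distrib]
    push_cast
    ring

end Shear

/-! ### Closedness when a three-dimensional summand is perfect. -/

theorem strictMono_three_four_cases : ∀ a b : Fin 4, a < b → ∀ c, b < c →
    ∃ m : Fin 4, a = m.succAbove 0 ∧ b = m.succAbove 1 ∧ c = m.succAbove 2 := by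
  decide +kernel

theorem eq_or_swap_of_ne_fin_three : ∀ k l : Fin 3, k ≠ l →
    ∃ j : Fin 3, (k = j + 1 ∧ l = j + 2) ∨ (k = j + 2 ∧ l = j + 1) := by
  decide +kernel

/-- An alternating five-form on a seven-dimensional space vanishes if its components of type
`(2, 3)`, `(3, 2)` and `(4, 1)` with respect to a decomposition of a basis do. -/
theorem eq_zero_of_components {V : Type*} [AddCommGroup V] [Module ℝ V]
    (e : Module.Basis (Fin 7) ℝ V) (f : V [⋀^Fin 5]→ₗ[ℝ] ℝ) (u : Fin 4 → V) (w : Fin 3 → V)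
    (hu : ∀ i : Fin 4, e (i.castAdd 3) = u i) (hw : ∀ j : Fin 3, e (j.natAdd 4) = w j)
    (h23 : ∀ i j, f ![w 0, w 1, w 2, u i, u j] = 0)
    (h32 : ∀ k l i j m, k ≠ l → f ![w k, w l, u i, u j, u m] = 0)
    (h41 : ∀ k i j m n, f ![w k, u i, u j, u m, u n] = 0) : f = 0 := by
  -- Reordering puts the W-vectors first, so that increasing tuples list them before the U-vectors.
  let e' : Module.Basis (Fin 7) ℝ V := e.reindex (finAddFlip (m := 4) (n := 3))
  have hw' (j : Fin 3) : e' (Fin.castAdd 4 j) = w j := by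
    rw [← hw, Module.Basis.reindex_apply]
    congr 1
    rw [Equiv.symm_apply_eq, finAddFlip_apply_natAdd]
  have hu' (i : Fin 4) : e' (Fin.natAdd 3 i) = u i := by
    rw [← hu, Module.Basis.reindex_apply]
    congr 1
    rw [Equiv.symm_apply_eq, finAddFlip_apply_castAdd]
  refine eq_zero_of_strictMono_basis e' f fun r hr => ?_
  have hrv : (fun i => e' (r i)) = ![e' (r 0), e' (r 1), e' (r 2), e' (r 3), e' (r 4)] := by
    ext i
    fin_cases i <;> rfl
  rw [hrv]
  have h01 : r 0 < r 1 := hr (by decide)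
  have h12 : r 1 < r 2 := hr (by decide)
  have h23' : r 2 < r 3 := hr (by decide)
  have h34 : r 3 < r 4 := hr (by decide)
  have hlow (a : Fin 7) (ha : a < 3) : ∃ k : Fin 3, a = Fin.castAdd 4 k :=
    ⟨⟨a, ha⟩, rfl⟩
  have hhigh (a : Fin 7) (ha : 3 ≤ a) : ∃ i : Fin 4, a = Fin.natAdd 3 i := by
    revert a; decide
  generalize r 0 = a at *
  generalize r 1 = b at *
  generalize r 2 = c at *
  generalize r 3 = d at *
  generalize r 4 = m at *
  -- An increasing five-tuple in seven indices has its last two entries at least 3 and its first at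
  -- most 2, which leaves only the types (2,3), (3,2), (4,1).
  obtain ⟨i₃, rfl⟩ := hhigh d (by omega)
  obtain ⟨i₄, rfl⟩ := hhigh m (by omega)
  obtain ⟨k, rfl⟩ := hlow a (by omega)
  rcases lt_or_ge b 3 with hb | hb
  · obtain ⟨l, rfl⟩ := hlow b hb
    rcases lt_or_ge c 3 with hc | hc
    · obtain ⟨n, rfl⟩ := hlow c hc
      have : k = 0 ∧ l = 1 ∧ n = 2 := by
        rw [Fin.lt_def] at h01 h12
        simp only [Fin.val_castAdd] at h01 h12
        omega
      obtain ⟨rfl, rfl, rfl⟩ := this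
      rw [hw', hw', hw', hu', hu']
      exact h23 _ _
    · obtain ⟨i, rfl⟩ := hhigh c hc
      rw [hw', hw', hu', hu', hu']
      exact h32 _ _ _ _ _ fun h => h01.ne (by rw [h])
  · obtain ⟨i, rfl⟩ := hhigh b hb
    obtain ⟨j, rfl⟩ := hhigh c (by omega)
    rw [hw', hu', hu', hu', hu']
    exact h41 _ _ _ _ _

/-- If a seven-dimensional Lie algebra is the direct sum of a four-dimensional one and a
three-dimensional perfect one, then it admits a cocalibrated `G₂`-structure. -/
theorem admitsCocalibratedG2Structure_of_basis {g : Type*} [LieRing g] [LieAlgebra ℝ g]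
    (e : Module.Basis (Fin 7) ℝ g) (S : Matrix (Fin 3) (Fin 3) ℝ) (hS : IsUnit S.det)
    (hsymm : ∀ i l, S i l = S l i)
    (huw : ∀ (i : Fin 4) (j : Fin 3), ⁅e (i.castAdd 3), e (j.natAdd 4)⁆ = 0)
    (huu : ∀ i j : Fin 4, ⁅e (i.castAdd 3), e (j.castAdd 3)⁆ ∈
      Submodule.span ℝ (Set.range fun i : Fin 4 => e (i.castAdd 3)))
    (hww : ∀ j : Fin 3, ⁅e ((j + 1).natAdd 4), e ((j + 2).natAdd 4)⁆ =
      ∑ l, S j l • e (Fin.natAdd 4 l)) :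
    AdmitsCocalibratedG2Structure g := by
  set u : Fin 4 → g := fun i => e (i.castAdd 3) with hu
  set w : Fin 3 → g := fun j => e (j.natAdd 4) with hw
  set U : Submodule ℝ g := Submodule.span ℝ (Set.range u) with hU
  have huU (i : Fin 4) : u i ∈ U := Submodule.subset_span ⟨i, rfl⟩
  have huw' (i : Fin 4) (j : Fin 3) : ⁅u i, w j⁆ = 0 := huw i j
  have huu' (i j : Fin 4) : ⁅u i, u j⁆ ∈ U := huu i j
  have hww' (j : Fin 3) : ⁅w (j + 1), w (j + 2)⁆ = ∑ l, S j l • w l := hww j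
  have hwU (j : Fin 3) (x : g) (hx : x ∈ U) : ⁅w j, x⁆ = 0 := by
    induction hx using Submodule.span_induction with
    | mem x hx =>
      obtain ⟨i, rfl⟩ := hx
      rw [← lie_skew, huw', neg_zero]
    | zero => simp
    | add x y _ _ hx hy => rw [lie_add, hx, hy, add_zero]
    | smul c x _ hx => rw [lie_smul, hx, smul_zero]
  have hUU (x y : g) (hx : x ∈ U) (hy : y ∈ U) : ⁅x, y⁆ ∈ U := by
    induction hx using Submodule.span_induction with
    | mem x hx =>
      obtain ⟨i, rfl⟩ := hx
      induction hy using Submodule.span_induction with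
      | mem y hy =>
        obtain ⟨j, rfl⟩ := hy
        exact huu' i j
      | zero => simp
      | add x y _ _ hx hy => rw [lie_add]; exact U.add_mem hx hy
      | smul c x _ hx => rw [lie_smul]; exact U.smul_mem _ hx
    | zero => simp
    | add x y _ _ hx hy => rw [add_lie]; exact U.add_mem hx hy
    | smul c x _ hx => rw [smul_lie]; exact U.smul_mem _ hx
  -- This is d_U of the two-form η(w (j+1), w (j+2), ·, ·). It is computed with `e` because the
  -- shear, not yet chosen, preserves the (2,2) part.
  let δ (j : Fin 3) (x y z : g) : ℝ :=
    -(starForm e ![⁅x, y⁆, w (j + 1), w (j + 2), z] - starForm e ![⁅x, z⁆, w (j + 1), w (j + 2), y]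
      + starForm e ![⁅y, z⁆, w (j + 1), w (j + 2), x])
  -- The type (3,2) equation is S T = δ.
  let T : Fin 3 → Fin 4 → ℝ := fun l m =>
    (S⁻¹.mulVec fun j => δ j (u (m.succAbove 0)) (u (m.succAbove 1)) (u (m.succAbove 2))) l
  obtain ⟨b, h13, h22, h31⟩ := exists_starForm e T
  refine admitsCocalibratedG2Structure_of_starForm b ?_
  set η := starForm b with hη
  have h13U (x : g) (hx : x ∈ U) (j k l : Fin 3) : η ![x, w j, w k, w l] = 0 := by
    induction hx using Submodule.span_induction with
    | mem x hx =>
      obtain ⟨i, rfl⟩ := hx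
      exact h13 i j k l
    | zero => exact four_zero _ _ _ _
    | add x y _ _ hx hy => rw [four_add, hx, hy, add_zero]
    | smul c x _ hx => rw [four_smul, hx, mul_zero]
  have h22U (x : g) (hx : x ∈ U) (k l : Fin 3) (q : Fin 4) :
      η ![x, w k, w l, u q] = starForm e ![x, w k, w l, u q] := by
    induction hx using Submodule.span_induction with
    | mem x hx =>
      obtain ⟨i, rfl⟩ := hx
      exact h22 i q k l
    | zero => rw [four_zero, four_zero]
    | add x y _ _ hx hy => rw [four_add, hx, hy, four_add]
    | smul c x _ hx => rw [four_smul, hx, four_smul]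
  set D : g [⋀^Fin 5]→ₗ[ℝ] ℝ := lieDifferentialForm η with hD
  have hD5 (x₀ x₁ x₂ x₃ x₄ : g) := lieDifferential_five η x₀ x₁ x₂ x₃ x₄
  simp only [← lieDifferentialForm_apply, ← hD] at hD5 ⊢
  have hD32 (j : Fin 3) (x y z : g) (hx : x ∈ U) (hy : y ∈ U) (hz : z ∈ U) :
      D ![w (j + 1), w (j + 2), x, y, z] = -η ![⁅w (j + 1), w (j + 2)⁆, x, y, z]
        - η ![⁅x, y⁆, w (j + 1), w (j + 2), z] + η ![⁅x, z⁆, w (j + 1), w (j + 2), y]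
        - η ![⁅y, z⁆, w (j + 1), w (j + 2), x] := by
    rw [hD5, hwU _ x hx, hwU _ y hy, hwU _ z hz, hwU _ x hx, hwU _ y hy, hwU _ z hz]
    simp only [four_zero]
    ring
  have h32 (j : Fin 3) (m : Fin 4) : D ![w (j + 1), w (j + 2), u (m.succAbove 0),
      u (m.succAbove 1), u (m.succAbove 2)] = 0 := by
    rw [hD32 _ _ _ _ (huU _) (huU _) (huU _), hww', four_sum, h22U _ (huu' _ _),
      h22U _ (huu' _ _), h22U _ (huu' _ _)]
    have hT : ∑ l, S j l * η ![w l, u (m.succAbove 0), u (m.succAbove 1), u (m.succAbove 2)] =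
        δ j (u (m.succAbove 0)) (u (m.succAbove 1)) (u (m.succAbove 2)) := by
      calc _ = ∑ l, S j l * T l m := Finset.sum_congr rfl fun l _ => by rw [← h31 l m]
        _ = (S.mulVec (S⁻¹.mulVec fun j =>
            δ j (u (m.succAbove 0)) (u (m.succAbove 1)) (u (m.succAbove 2)))) j := rfl
        _ = _ := by rw [Matrix.mulVec_mulVec, Matrix.mul_nonsing_inv _ hS, Matrix.one_mulVec]
    rw [hT]
    ring
  -- Parametrizing U by ℝ⁴ extends the vanishing from increasing triples of basis vectors to all
  -- triples in U.
  let ι : (Fin 4 → ℝ) →ₗ[ℝ] g := (Pi.basisFun ℝ (Fin 4)).constr ℝ u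
  have hι (i : Fin 4) : ι (Pi.basisFun ℝ (Fin 4) i) = u i := Module.Basis.constr_basis _ _ _ _
  have hιU (x : g) (hx : x ∈ U) : ∃ y, ι y = x := by
    have : LinearMap.range ι = U := Module.Basis.constr_range _ _
    rwa [← this] at hx
  have h32U (j : Fin 3) (x y z : g) (hx : x ∈ U) (hy : y ∈ U) (hz : z ∈ U) :
      D ![w (j + 1), w (j + 2), x, y, z] = 0 := by
    have h0 : ((D.curryLeft (w (j + 1))).curryLeft (w (j + 2))).compLinearMap ι = 0 := by
      refine eq_zero_of_strictMono_basis (Pi.basisFun ℝ (Fin 4)) _ fun r hr => ?_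
      obtain ⟨m, h0, h1, h2⟩ := strictMono_three_four_cases (r 0) (r 1) (hr (by decide)) (r 2)
        (hr (by decide))
      rw [← h32 j m, ← h0, ← h1, ← h2, AlternatingMap.compLinearMap_apply,
        AlternatingMap.curryLeft_apply_apply, AlternatingMap.curryLeft_apply_apply]
      congr 1
      ext i
      fin_cases i
      exacts [rfl, rfl, hι _, hι _, hι _]
    obtain ⟨x, rfl⟩ := hιU x hx
    obtain ⟨y, rfl⟩ := hιU y hy
    obtain ⟨z, rfl⟩ := hιU z hz
    have := congrArg (fun f => f ![x, y, z]) h0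
    rw [AlternatingMap.compLinearMap_apply, AlternatingMap.curryLeft_apply_apply,
      AlternatingMap.curryLeft_apply_apply] at this
    rw [← AlternatingMap.zero_apply (R := ℝ) (M := Fin 4 → ℝ) (N := ℝ) ![x, y, z], ← this]
    congr 1
    ext i
    fin_cases i <;> rfl
  have h32' (k l : Fin 3) (hkl : k ≠ l) (x y z : g) (hx : x ∈ U) (hy : y ∈ U) (hz : z ∈ U) :
      D ![w k, w l, x, y, z] = 0 := by
    obtain ⟨j, ⟨rfl, rfl⟩ | ⟨rfl, rfl⟩⟩ := eq_or_swap_of_ne_fin_three k l hkl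
    · exact h32U j x y z hx hy hz
    · rw [← neg_eq_zero, ← D.map_swap _ (show (0 : Fin 5) ≠ 1 by decide),
        ← h32U j x y z hx hy hz]
      congr 1
      ext i
      fin_cases i <;> rfl
  have hδ (j : Fin 3) (x y z : g) (hx : x ∈ U) (hy : y ∈ U) (hz : z ∈ U) :
      η ![⁅w (j + 1), w (j + 2)⁆, x, y, z] = - η ![⁅x, y⁆, w (j + 1), w (j + 2), z]
        + η ![⁅x, z⁆, w (j + 1), w (j + 2), y] - η ![⁅y, z⁆, w (j + 1), w (j + 2), x] := by
    have := h32U j x y z hx hy hz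
    rw [hD32 j x y z hx hy hz] at this
    linarith
  have h41 (l : Fin 3) (p q r s : g) (hp : p ∈ U) (hq : q ∈ U) (hr : r ∈ U) (hs : s ∈ U) :
      D ![w l, p, q, r, s] = 0 := by
    -- It suffices to treat brackets, as these span W. There `hδ` trades each (3,1) value of η for
    -- (2,2) values, and what remains is d_U² = 0 on a two-form: `hJ` is the Jacobi identity and
    -- `hω` the antisymmetry.
    have hc (j : Fin 3) : D ![⁅w (j + 1), w (j + 2)⁆, p, q, r, s] = 0 := by
      have hcU (x : g) (hx : x ∈ U) : ⁅⁅w (j + 1), w (j + 2)⁆, x⁆ = 0 := by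
        rw [lie_lie, hwU _ x hx, hwU _ x hx, lie_zero, lie_zero, sub_zero]
      rw [hD5, hcU p hp, hcU q hq, hcU r hr, hcU s hs]
      simp only [four_zero, four_swap_01 η ⁅w (j + 1), w (j + 2)⁆]
      rw [hδ j _ _ _ (hUU p q hp hq) hr hs, hδ j _ _ _ (hUU p r hp hr) hq hs,
        hδ j _ _ _ (hUU p s hp hs) hq hr, hδ j _ _ _ (hUU q r hq hr) hp hs,
        hδ j _ _ _ (hUU q s hq hs) hp hr, hδ j _ _ _ (hUU r s hr hs) hp hq]
      generalize w (j + 1) = a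
      generalize w (j + 2) = b'
      have hω (x y : g) : η ![x, a, b', y] = -η ![y, a, b', x] := by
        rw [← η.map_swap ![y, a, b', x] (show (0 : Fin 4) ≠ 3 by decide)]
        congr 1
        ext i
        fin_cases i <;> rfl
      have hJ (x y z v : g) : η ![⁅⁅x, y⁆, z⁆, a, b', v] - η ![⁅⁅x, z⁆, y⁆, a, b', v]
          + η ![⁅⁅y, z⁆, x⁆, a, b', v] = 0 := by
        have : ⁅⁅x, y⁆, z⁆ = ⁅⁅x, z⁆, y⁆ + -⁅⁅y, z⁆, x⁆ := by
          rw [lie_lie, ← lie_skew ⁅x, z⁆ y, ← lie_skew ⁅y, z⁆ x]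
          abel
        rw [this, four_add, four_neg]
        ring
      linarith [hJ p q r s, hJ p q s r, hJ p r s q, hJ q r s p, hω ⁅p, q⁆ ⁅r, s⁆,
        hω ⁅p, r⁆ ⁅q, s⁆, hω ⁅p, s⁆ ⁅q, r⁆]
    let ℓ : g →ₗ[ℝ] ℝ :=
      { toFun := fun x => D ![x, p, q, r, s]
        map_add' := fun x y => D.map_vecCons_add _ _ _
        map_smul' := fun c x => D.map_vecCons_smul _ _ _ }
    have hwl : w l = ∑ j, S⁻¹ l j • ⁅w (j + 1), w (j + 2)⁆ := by
      have hSS (m : Fin 3) : ∑ j, S⁻¹ l j * S j m = (1 : Matrix (Fin 3) (Fin 3) ℝ) l m := by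
        rw [← Matrix.mul_apply, Matrix.nonsing_inv_mul _ hS]
      simp only [hww', Finset.smul_sum, smul_smul]
      rw [Finset.sum_comm]
      simp only [← Finset.sum_smul, hSS, Matrix.one_apply]
      simp
    change ℓ (w l) = 0
    rw [hwl, map_sum]
    refine Finset.sum_eq_zero fun j _ => ?_
    rw [map_smul, show ℓ ⁅w (j + 1), w (j + 2)⁆ = 0 from hc j, smul_zero]
  -- The term with ⁅p, q⁆ is of type (1,3) and vanishes. In the others the diagonal entries of S
  -- drop out and the off-diagonal ones cancel by symmetry.
  have h23 (p q : g) (hp : p ∈ U) (hq : q ∈ U) : D ![w 0, w 1, w 2, p, q] = 0 := by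
    have h0 : ⁅w 1, w 2⁆ = ∑ l, S 0 l • w l := hww' 0
    have h1 : ⁅w 2, w 0⁆ = ∑ l, S 1 l • w l := hww' 1
    have h2 : ⁅w 0, w 1⁆ = ∑ l, S 2 l • w l := hww' 2
    rw [hD5, hwU _ p hp, hwU _ p hp, hwU _ p hp, hwU _ q hq, hwU _ q hq, hwU _ q hq,
      h13U _ (hUU p q hp hq), ← lie_skew (w 0) (w 2), four_neg, h0, h1, h2]
    simp only [four_zero, four_sum]
    simp only [Fin.sum_univ_three]
    have hd (x : g) : η ![x, x, p, q] = 0 := by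
      have := four_swap_01 η x x p q
      linarith
    rw [hd, hd, hd, four_swap_01 η (w 0) (w 1), four_swap_01 η (w 0) (w 2),
      four_swap_01 η (w 1) (w 2), hsymm 1 0, hsymm 2 0, hsymm 2 1]
    ring
  suffices hD0 : D = 0 by
    intro x
    rw [hD0, AlternatingMap.zero_apply]
  exact eq_zero_of_components e D u w (fun _ => rfl) (fun _ => rfl)
    (fun _ _ => h23 _ _ (huU _) (huU _))
    (fun _ _ _ _ _ h => h32' _ _ h _ _ _ (huU _) (huU _) (huU _))
    (fun _ _ _ _ _ => h41 _ _ _ _ _ (huU _) (huU _) (huU _) (huU _))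

/-! ### Perfect ideals and their structure in dimension three. -/

/-- An ideal which is spanned by the brackets of its elements. -/
structure IsPerfectIdeal {g : Type*} [LieRing g] [LieAlgebra ℝ g] (P : Submodule ℝ g) : Prop where
  lie_mem : ∀ x : g, ∀ y ∈ P, ⁅x, y⁆ ∈ P
  le_span : P ≤ Submodule.span ℝ {m | ∃ x ∈ P, ∃ y ∈ P, ⁅x, y⁆ = m}

section Perfect

variable {g : Type*} [LieRing g] [LieAlgebra ℝ g]

/-- A nonzero term of the derived series that equals its successor is a perfect ideal. Without one,
the dimension drops at every step until it is zero. -/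
theorem exists_isPerfectIdeal [FiniteDimensional ℝ g] (h : ¬ LieAlgebra.IsSolvable g) :
    ∃ P : Submodule ℝ g, IsPerfectIdeal P ∧ P ≠ ⊥ := by
  by_contra! hc
  have hstep (k : ℕ) : LieAlgebra.derivedSeries ℝ g k ≠ ⊥ →
      LieAlgebra.derivedSeries ℝ g (k + 1) < LieAlgebra.derivedSeries ℝ g k := by
    intro hk
    refine lt_of_le_of_ne (LieAlgebra.derivedSeriesOfIdeal_succ_le _ _) fun heq => hk ?_
    rw [LieAlgebra.derivedSeries_def, LieAlgebra.derivedSeriesOfIdeal_succ] at heq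
    rw [← LieSubmodule.toSubmodule_eq_bot]
    refine hc _ ⟨fun x y hy => LieSubmodule.lie_mem _ hy, ?_⟩
    have hspan := LieSubmodule.lieIdeal_oper_eq_linear_span' (R := ℝ)
      (LieAlgebra.derivedSeries ℝ g k) (LieAlgebra.derivedSeries ℝ g k)
    rw [heq] at hspan
    exact hspan.le
  have hrank (k : ℕ) : LieAlgebra.derivedSeries ℝ g k = ⊥ ∨
      Module.finrank ℝ (LieAlgebra.derivedSeries ℝ g k).toSubmodule + k ≤ Module.finrank ℝ g := by
    induction k with
    | zero => exact .inr (Submodule.finrank_le _)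
    | succ k ih =>
      by_cases hk : LieAlgebra.derivedSeries ℝ g k = ⊥
      · left
        have := LieAlgebra.derivedSeriesOfIdeal_succ_le (R := ℝ) (L := g) ⊤ k
        rw [← LieAlgebra.derivedSeries_def, ← LieAlgebra.derivedSeries_def, hk] at this
        exact le_bot_iff.1 this
      · right
        have h1 := Submodule.finrank_lt_finrank_of_lt
          (show (LieAlgebra.derivedSeries ℝ g (k + 1)).toSubmodule <
            (LieAlgebra.derivedSeries ℝ g k).toSubmodule from hstep k hk)
        have h2 := ih.resolve_left hk
        omega
  refine h (LieAlgebra.IsSolvable.mk (R := ℝ) (k := Module.finrank ℝ g) ?_)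
  refine (hrank _).elim id fun hk => ?_
  rw [← LieSubmodule.toSubmodule_eq_bot, ← Submodule.finrank_eq_zero]
  omega

theorem IsPerfectIdeal.map {g' : Type*} [LieRing g'] [LieAlgebra ℝ g'] {P : Submodule ℝ g}
    (hP : IsPerfectIdeal P) (f : g →ₗ⁅ℝ⁆ g') (hf : Function.Surjective f) :
    IsPerfectIdeal (P.map (f : g →ₗ[ℝ] g')) where
  lie_mem := by
    rintro x _ ⟨y, hy, rfl⟩
    obtain ⟨x, rfl⟩ := hf x
    exact ⟨⁅x, y⁆, hP.lie_mem x y hy, f.map_lie x y⟩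
  le_span := by
    refine (Submodule.map_mono hP.le_span).trans ?_
    rw [Submodule.map_span, Submodule.span_le]
    rintro _ ⟨_, ⟨x, hx, y, hy, rfl⟩, rfl⟩
    exact Submodule.subset_span ⟨f x, ⟨x, hx, rfl⟩, f y, ⟨y, hy, rfl⟩, (f.map_lie x y).symm⟩

theorem lie_mem_of_mem_span {s : Set g} {Q : Submodule ℝ g} (h : ∀ x ∈ s, ∀ y ∈ s, ⁅x, y⁆ ∈ Q)
    {x y : g} (hx : x ∈ Submodule.span ℝ s) (hy : y ∈ Submodule.span ℝ s) : ⁅x, y⁆ ∈ Q := by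
  induction hx using Submodule.span_induction with
  | mem x hx =>
    induction hy using Submodule.span_induction with
    | mem y hy => exact h x hx y hy
    | zero => simp
    | add y z _ _ hy hz => rw [lie_add]; exact Q.add_mem hy hz
    | smul c y _ hy => rw [lie_smul]; exact Q.smul_mem c hy
  | zero => simp
  | add x z _ _ hx hz => rw [add_lie]; exact Q.add_mem hx hz
  | smul c x _ hx => rw [smul_lie]; exact Q.smul_mem c hx

theorem IsPerfectIdeal.le_of_lie_mem {P Q : Submodule ℝ g} (hP : IsPerfectIdeal P) {s : Set g}
    (hs : Submodule.span ℝ s = P) (h : ∀ x ∈ s, ∀ y ∈ s, ⁅x, y⁆ ∈ Q) : P ≤ Q := by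
  refine hP.le_span.trans (Submodule.span_le.2 ?_)
  rintro _ ⟨x, hx, y, hy, rfl⟩
  rw [← hs] at hx hy
  exact lie_mem_of_mem_span h hx hy

theorem exists_span_range_eq {V : Type*} [AddCommGroup V] [Module ℝ V] [FiniteDimensional ℝ V]
    (P : Submodule ℝ V) {n : ℕ} (hn : Module.finrank ℝ P = n) :
    ∃ w : Fin n → V, LinearIndependent ℝ w ∧ Submodule.span ℝ (Set.range w) = P := by
  let b := Module.finBasisOfFinrankEq ℝ P hn
  refine ⟨fun i => b i, b.linearIndependent.map' P.subtype P.ker_subtype, ?_⟩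
  have := congrArg (Submodule.map P.subtype) b.span_eq
  rwa [Submodule.map_span, Submodule.map_top, Submodule.range_subtype, ← Set.range_comp] at this

/-- Brackets of elements of a space of dimension n span at most n(n-1)/2 dimensions, which is less
than n for n = 1, 2. -/
theorem IsPerfectIdeal.three_le_finrank [FiniteDimensional ℝ g] {P : Submodule ℝ g}
    (hP : IsPerfectIdeal P) (h0 : P ≠ ⊥) : 3 ≤ Module.finrank ℝ P := by
  by_contra! hlt
  obtain h | h | h : Module.finrank ℝ P = 0 ∨ Module.finrank ℝ P = 1 ∨ Module.finrank ℝ P = 2 := by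
    omega
  · exact h0 (Submodule.finrank_eq_zero.1 h)
  · obtain ⟨w, -, hw⟩ := exists_span_range_eq P h
    refine h0 (le_bot_iff.1 (hP.le_of_lie_mem hw ?_))
    rintro _ ⟨i, rfl⟩ _ ⟨j, rfl⟩
    rw [Subsingleton.elim i j, lie_self]
    exact Submodule.zero_mem _
  · obtain ⟨w, -, hw⟩ := exists_span_range_eq P h
    have hle : P ≤ Submodule.span ℝ {⁅w 0, w 1⁆} := by
      refine hP.le_of_lie_mem hw ?_
      have h01 := Submodule.mem_span_singleton_self (R := ℝ) ⁅w 0, w 1⁆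
      have h10 := Submodule.neg_mem _ h01
      rw [lie_skew] at h10
      rintro _ ⟨i, rfl⟩ _ ⟨j, rfl⟩
      fin_cases i <;> fin_cases j <;> simp only [lie_self] <;>
        first | exact Submodule.zero_mem _ | assumption
    have := (Submodule.finrank_mono hle).trans (finrank_span_le_card _)
    simp only [Set.toFinset_singleton, Finset.card_singleton] at this
    omega

/-- S is invertible because the three cyclic brackets span P. The Jacobi identity for the basis says
that the vector of antisymmetric parts of S is annihilated by S, so S is symmetric. -/
theorem exists_structure_matrix [FiniteDimensional ℝ g] {P : Submodule ℝ g}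
    (hP : IsPerfectIdeal P) (h3 : Module.finrank ℝ P = 3) :
    ∃ (w : Fin 3 → g) (S : Matrix (Fin 3) (Fin 3) ℝ), LinearIndependent ℝ w ∧
      Submodule.span ℝ (Set.range w) = P ∧ IsUnit S.det ∧ (∀ i l, S i l = S l i) ∧
      ∀ j, ⁅w (j + 1), w (j + 2)⁆ = ∑ l, S j l • w l := by
  obtain ⟨w, hw, hspan⟩ := exists_span_range_eq P h3
  have hmem (j : Fin 3) : w j ∈ P := hspan ▸ Submodule.subset_span ⟨j, rfl⟩
  have hcoord (x : g) (hx : x ∈ P) : ∃ c : Fin 3 → ℝ, ∑ l, c l • w l = x := by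
    rw [← hspan] at hx
    exact (Submodule.mem_span_range_iff_exists_fun ℝ).1 hx
  choose S hS using fun j : Fin 3 => hcoord ⁅w (j + 1), w (j + 2)⁆ (hP.lie_mem _ _ (hmem _))
  have hle : P ≤ Submodule.span ℝ (Set.range fun j : Fin 3 => ⁅w (j + 1), w (j + 2)⁆) := by
    refine hP.le_of_lie_mem hspan ?_
    have h0 : ⁅w 1, w 2⁆ ∈ Submodule.span ℝ (Set.range fun j : Fin 3 => ⁅w (j + 1), w (j + 2)⁆) :=
      Submodule.subset_span ⟨0, rfl⟩
    have h1 : ⁅w 2, w 0⁆ ∈ Submodule.span ℝ (Set.range fun j : Fin 3 => ⁅w (j + 1), w (j + 2)⁆) :=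
      Submodule.subset_span ⟨1, rfl⟩
    have h2 : ⁅w 0, w 1⁆ ∈ Submodule.span ℝ (Set.range fun j : Fin 3 => ⁅w (j + 1), w (j + 2)⁆) :=
      Submodule.subset_span ⟨2, rfl⟩
    have h0' := Submodule.neg_mem _ h0
    have h1' := Submodule.neg_mem _ h1
    have h2' := Submodule.neg_mem _ h2
    rw [lie_skew] at h0' h1' h2'
    rintro _ ⟨i, rfl⟩ _ ⟨j, rfl⟩
    fin_cases i <;> fin_cases j <;> simp only [lie_self] <;>
      first | exact Submodule.zero_mem _ | assumption
  choose A hA using fun l : Fin 3 =>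
    (Submodule.mem_span_range_iff_exists_fun ℝ).1 (hle (hmem l))
  have hAS : Matrix.of A * Matrix.of S = 1 := by
    ext l m
    have h := hA l
    simp only [← hS, Finset.smul_sum, smul_smul] at h
    rw [Finset.sum_comm] at h
    simp only [← Finset.sum_smul] at h
    have h' : ∑ m, (Matrix.of A * Matrix.of S) l m • w m =
        ∑ m, (1 : Matrix (Fin 3) (Fin 3) ℝ) l m • w m := by
      simp only [Matrix.mul_apply, Matrix.of_apply, h]
      simp [Matrix.one_apply]
    rw [← sub_eq_zero, ← Finset.sum_sub_distrib] at h'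
    simp only [← sub_smul] at h'
    exact sub_eq_zero.1 (Fintype.linearIndependent_iff.1 hw _ h' m)
  have hunit : IsUnit (Matrix.of S).det :=
    Matrix.isUnit_det_of_left_inverse hAS
  have hanti : ![S 1 2 - S 2 1, S 2 0 - S 0 2, S 0 1 - S 1 0] = 0 := by
    refine Matrix.eq_zero_of_vecMul_eq_zero hunit.ne_zero (M := Matrix.of S) ?_
    ext m
    refine Fintype.linearIndependent_iff.1 hw _ ?_ m
    have hJ := lie_jacobi (w 0) (w 1) (w 2)
    have e0 : ⁅w 1, w 2⁆ = ∑ l, S 0 l • w l := (hS 0).symm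
    have e1 : ⁅w 2, w 0⁆ = ∑ l, S 1 l • w l := (hS 1).symm
    have e2 : ⁅w 0, w 1⁆ = ∑ l, S 2 l • w l := (hS 2).symm
    rw [e0, e1, e2] at hJ
    simp only [Fin.sum_univ_three, lie_add, lie_smul, lie_self, smul_zero] at hJ e0 e1 e2
    rw [← lie_skew (w 1) (w 0), ← lie_skew (w 2) (w 1), ← lie_skew (w 0) (w 2), e0, e1, e2] at hJ
    simp only [Fin.sum_univ_three, Matrix.vecMul, dotProduct, Matrix.of_apply, Matrix.cons_val]
    rw [← hJ]
    module
  refine ⟨w, Matrix.of S, hw, hspan, hunit, ?_, fun j => (hS j).symm⟩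
  have a0 := congrFun hanti 0
  have a1 := congrFun hanti 1
  have a2 := congrFun hanti 2
  simp only [Matrix.cons_val, Pi.zero_apply] at a0 a1 a2
  intro i l
  fin_cases i <;> fin_cases l <;> simp only [Matrix.of_apply, Fin.isValue, Fin.zero_eta,
    Fin.mk_one, Fin.reduceFinMk] <;> linarith

end Perfect

/-! ### Perfect ideals in four-dimensional Lie algebras. -/

section Perfect

variable {g : Type*} [LieRing g] [LieAlgebra ℝ g]

/-- The adjoint map of a bracket is a commutator, hence traceless, and brackets span. -/
theorem trace_ad_eq_zero (hg : IsPerfectIdeal (⊤ : Submodule ℝ g)) (x : g) :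
    LinearMap.trace ℝ g (LieAlgebra.ad ℝ g x) = 0 := by
  have hx : x ∈ Submodule.span ℝ {m : g | ∃ x ∈ (⊤ : Submodule ℝ g), ∃ y ∈ (⊤ : Submodule ℝ g),
      ⁅x, y⁆ = m} := hg.le_span Submodule.mem_top
  induction hx using Submodule.span_induction with
  | mem x hx =>
    obtain ⟨y, -, z, -, rfl⟩ := hx
    have h : (LieAlgebra.ad ℝ g ⁅y, z⁆ : Module.End ℝ g) =
        LieAlgebra.ad ℝ g y * LieAlgebra.ad ℝ g z - LieAlgebra.ad ℝ g z * LieAlgebra.ad ℝ g y := by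
      ext v
      simp
    rw [h, map_sub, LinearMap.trace_mul_comm, sub_self]
  | zero => simp
  | add x y _ _ hx hy => rw [map_add, map_add, hx, hy, add_zero]
  | smul c x _ hx => rw [map_smul, map_smul, hx, smul_zero]

/-- In a perfect four-dimensional Lie algebra `dα ∧ dβ = 0` for all one-forms `α` and `β`. -/
theorem sum_smul_lie_eq_zero (hg : IsPerfectIdeal (⊤ : Submodule ℝ g))
    (x : Module.Basis (Fin 4) ℝ g) (α : Module.Dual ℝ g) :
    α ⁅x 2, x 3⁆ • ⁅x 0, x 1⁆ - α ⁅x 1, x 3⁆ • ⁅x 0, x 2⁆ + α ⁅x 1, x 2⁆ • ⁅x 0, x 3⁆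
      + α ⁅x 0, x 3⁆ • ⁅x 1, x 2⁆ - α ⁅x 0, x 2⁆ • ⁅x 1, x 3⁆ + α ⁅x 0, x 1⁆ • ⁅x 2, x 3⁆ = 0 := by
  have htr (y : g) : x.coord 0 ⁅y, x 0⁆ + x.coord 1 ⁅y, x 1⁆ + x.coord 2 ⁅y, x 2⁆
      + x.coord 3 ⁅y, x 3⁆ = 0 := by
    have := trace_ad_eq_zero hg y
    rw [LinearMap.trace_eq_matrix_trace ℝ x, Matrix.trace, Fin.sum_univ_four] at this
    simpa [LinearMap.toMatrix_apply] using this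
  have h10 : ⁅x 1, x 0⁆ = -⁅x 0, x 1⁆ := (lie_skew _ _).symm
  have h20 : ⁅x 2, x 0⁆ = -⁅x 0, x 2⁆ := (lie_skew _ _).symm
  have h30 : ⁅x 3, x 0⁆ = -⁅x 0, x 3⁆ := (lie_skew _ _).symm
  have h21 : ⁅x 2, x 1⁆ = -⁅x 1, x 2⁆ := (lie_skew _ _).symm
  have h31 : ⁅x 3, x 1⁆ = -⁅x 1, x 3⁆ := (lie_skew _ _).symm
  have h32 : ⁅x 3, x 2⁆ = -⁅x 2, x 3⁆ := (lie_skew _ _).symm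
  have t0 := htr (x 0)
  have t1 := htr (x 1)
  have t2 := htr (x 2)
  have t3 := htr (x 3)
  simp only [lie_self, h10, h20, h30, h21, h31, h32, map_neg, map_zero] at t0 t1 t2 t3
  have hexp (z y : g) : ⁅y, z⁆ = x.coord 0 z • ⁅y, x 0⁆ + x.coord 1 z • ⁅y, x 1⁆
      + x.coord 2 z • ⁅y, x 2⁆ + x.coord 3 z • ⁅y, x 3⁆ := by
    conv_lhs => rw [← x.sum_repr z, Fin.sum_univ_four]
    simp only [lie_add, lie_smul, Module.Basis.coord_apply]
  have j0 := lie_jacobi (x 1) (x 2) (x 3)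
  have j1 := lie_jacobi (x 0) (x 2) (x 3)
  have j2 := lie_jacobi (x 0) (x 1) (x 3)
  have j3 := lie_jacobi (x 0) (x 1) (x 2)
  simp only [hexp ⁅_, _⁆] at j0 j1 j2 j3
  simp only [lie_self, h10, h20, h30, h21, h31, h32, map_neg] at j0 j1 j2 j3
  have hα (z : g) : α z = α (x 0) * x.coord 0 z + α (x 1) * x.coord 1 z + α (x 2) * x.coord 2 z
      + α (x 3) * x.coord 3 z := by
    conv_lhs => rw [← x.sum_repr z, Fin.sum_univ_four]
    simp only [map_add, map_smul, Module.Basis.coord_apply, smul_eq_mul]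
    ring
  have v0 := congrArg (fun v => α (x 0) • v) j0
  have v1 := congrArg (fun v => α (x 1) • v) j1
  have v2 := congrArg (fun v => α (x 2) • v) j2
  have v3 := congrArg (fun v => α (x 3) • v) j3
  simp only [smul_zero] at v0 v1 v2 v3
  simp only [hα ⁅_, _⁆]
  -- This is dα ∧ dβ = d(α ∧ dβ) with β left free: the Jacobi identities `v0`–`v3` express d² = 0,
  -- and the trace conditions `t0`–`t3` make exact four-forms vanish.
  linear_combination (norm := module) -v0 + v1 - v2 + v3
    + t0 • (α (x 1) • ⁅x 2, x 3⁆ - α (x 2) • ⁅x 1, x 3⁆ + α (x 3) • ⁅x 1, x 2⁆)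
    - t1 • (α (x 0) • ⁅x 2, x 3⁆ - α (x 2) • ⁅x 0, x 3⁆ + α (x 3) • ⁅x 0, x 2⁆)
    + t2 • (α (x 0) • ⁅x 1, x 3⁆ - α (x 1) • ⁅x 0, x 3⁆ + α (x 3) • ⁅x 0, x 1⁆)
    - t3 • (α (x 0) • ⁅x 1, x 2⁆ - α (x 1) • ⁅x 0, x 2⁆ + α (x 2) • ⁅x 0, x 1⁆)

/-- There is no perfect four-dimensional Lie algebra. -/
theorem not_isPerfectIdeal_top (h4 : Module.finrank ℝ g = 4) :
    ¬ IsPerfectIdeal (⊤ : Submodule ℝ g) := by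
  intro hg
  have : FiniteDimensional ℝ g := Module.finite_of_finrank_eq_succ h4
  let x := Module.finBasisOfFinrankEq ℝ g h4
  let p : Fin 6 → Fin 4 × Fin 4 := ![(0, 1), (0, 2), (0, 3), (1, 2), (1, 3), (2, 3)]
  let B : (Fin 6 → ℝ) →ₗ[ℝ] g := (Pi.basisFun ℝ (Fin 6)).constr ℝ fun m => ⁅x (p m).1, x (p m).2⁆
  have hBapply (c : Fin 6 → ℝ) : B c = ∑ m, c m • ⁅x (p m).1, x (p m).2⁆ := by
    simp [B, Module.Basis.constr_apply_fintype]
  have hmem (m : Fin 6) : ⁅x (p m).1, x (p m).2⁆ ∈ LinearMap.range B :=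
    ⟨Pi.basisFun ℝ (Fin 6) m, Module.Basis.constr_basis _ _ _ _⟩
  have hBrange : LinearMap.range B = ⊤ := by
    refine top_le_iff.1 (hg.le_of_lie_mem x.span_eq ?_)
    have hne (i j : Fin 4) : i = j ∨ (∃ m, p m = (i, j)) ∨ ∃ m, p m = (j, i) := by
      revert i j; decide
    rintro _ ⟨i, rfl⟩ _ ⟨j, rfl⟩
    obtain rfl | ⟨m, hm⟩ | ⟨m, hm⟩ := hne i j
    · rw [lie_self]; exact Submodule.zero_mem _
    · have := hmem m
      rwa [hm] at this
    · have := Submodule.neg_mem _ (hmem m)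
      rwa [hm, lie_skew] at this
  -- L is, up to sign, α ↦ dα with two-forms identified with bivectors by the wedge pairing.
  -- Perfectness makes L injective and the bracket map B surjective, so dα ∧ dβ = 0 would put a
  -- four-dimensional range into a two-dimensional kernel.
  let L : Module.Dual ℝ g →ₗ[ℝ] (Fin 6 → ℝ) :=
    LinearMap.pi ![Module.Dual.eval ℝ g ⁅x 2, x 3⁆, -Module.Dual.eval ℝ g ⁅x 1, x 3⁆,
      Module.Dual.eval ℝ g ⁅x 1, x 2⁆, Module.Dual.eval ℝ g ⁅x 0, x 3⁆,
      -Module.Dual.eval ℝ g ⁅x 0, x 2⁆, Module.Dual.eval ℝ g ⁅x 0, x 1⁆]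
  have hLB : LinearMap.range L ≤ LinearMap.ker B := by
    rintro _ ⟨α, rfl⟩
    rw [LinearMap.mem_ker, hBapply, ← sum_smul_lie_eq_zero hg x α]
    simp [Fin.sum_univ_succ, L, p]
    module
  have hLker : LinearMap.ker L = ⊥ := by
    refine LinearMap.ker_eq_bot'.2 fun α hα => ?_
    have hα' (m : Fin 6) : α ⁅x (p m).1, x (p m).2⁆ = 0 := by
      have h0 := congrFun hα 0
      have h1 := congrFun hα 1
      have h2 := congrFun hα 2
      have h3 := congrFun hα 3
      have h4 := congrFun hα 4
      have h5 := congrFun hα 5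
      simp only [L, LinearMap.pi_apply, Matrix.cons_val, Module.Dual.eval_apply, Pi.zero_apply,
        LinearMap.neg_apply, neg_eq_zero] at h0 h1 h2 h3 h4 h5
      fin_cases m
      exacts [h5, h4, h3, h2, h1, h0]
    have hcomp : α ∘ₗ B = 0 := by
      refine LinearMap.ext fun c => ?_
      simp [hBapply, hα']
    rw [LinearMap.range_eq_top] at hBrange
    ext z
    obtain ⟨c, rfl⟩ := hBrange z
    exact LinearMap.congr_fun hcomp c
  have r1 := Submodule.finrank_mono hLB
  have r2 := LinearMap.finrank_range_add_finrank_ker B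
  have r3 := LinearMap.finrank_range_of_inj (LinearMap.ker_eq_bot.1 hLker)
  rw [Subspace.dual_finrank_eq, h4] at r3
  rw [hBrange, finrank_top, h4, Module.finrank_fin_fun] at r2
  omega

/-- A perfect ideal of codimension one has a central complement. -/
theorem exists_central_complement (h4 : Module.finrank ℝ g = 4) {P : Submodule ℝ g}
    (hP : IsPerfectIdeal P) {w : Fin 3 → g} {S : Matrix (Fin 3) (Fin 3) ℝ}
    (hw : LinearIndependent ℝ w) (hspan : Submodule.span ℝ (Set.range w) = P)
    (hS : IsUnit S.det) (hsymm : ∀ i l, S i l = S l i)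
    (hww : ∀ j, ⁅w (j + 1), w (j + 2)⁆ = ∑ l, S j l • w l) :
    ∃ z, z ∉ P ∧ ∀ j, ⁅z, w j⁆ = 0 := by
  have : FiniteDimensional ℝ g := Module.finite_of_finrank_eq_succ h4
  let ι : (Fin 3 → ℝ) →ₗ[ℝ] g := Fintype.linearCombination ℝ w
  have hι (c : Fin 3 → ℝ) : ι c = ∑ i, c i • w i := Fintype.linearCombination_apply ℝ w c
  have hker : LinearMap.ker ι = ⊥ := by
    refine LinearMap.ker_eq_bot'.2 fun c hc => ?_
    rw [hι] at hc
    exact funext (Fintype.linearIndependent_iff.1 hw c hc)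
  obtain ⟨A, hA⟩ := ι.exists_leftInverse_of_injective hker
  have hAι (c : Fin 3 → ℝ) : A (∑ i, c i • w i) = c := by
    rw [← hι]; exact LinearMap.congr_fun hA c
  have hAP (x : g) (hx : x ∈ P) : ∑ i, A x i • w i = x := by
    rw [← hspan] at hx
    obtain ⟨c, rfl⟩ := (Submodule.mem_span_range_iff_exists_fun ℝ).1 hx
    rw [hAι]
  have hmem (j : Fin 3) : w j ∈ P := hspan ▸ Submodule.subset_span ⟨j, rfl⟩
  -- With N the matrix of ad y on P, these are the entries of S N above the diagonal. Three
  -- conditions on a four-dimensional space leave a nonzero solution.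
  let Φ : g →ₗ[ℝ] (Fin 3 → ℝ) :=
    { toFun := fun y => ![A ⁅y, ⁅w 1, w 2⁆⁆ 1, A ⁅y, ⁅w 1, w 2⁆⁆ 2, A ⁅y, ⁅w 2, w 0⁆⁆ 2]
      map_add' := fun y z => by simp
      map_smul' := fun c y => by simp }
  obtain ⟨z, hz, hz0⟩ := (Submodule.ne_bot_iff _).1
    (LinearMap.ker_ne_bot_of_finrank_lt (f := Φ) (by simp [h4]))
  let N : Matrix (Fin 3) (Fin 3) ℝ := Matrix.of fun l p => A ⁅z, w l⁆ p
  have hN (l : Fin 3) : ⁅z, w l⁆ = ∑ p, N l p • w p := (hAP _ (hP.lie_mem _ _ (hmem l))).symm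
  have hSN (i : Fin 3) : ⁅z, ⁅w (i + 1), w (i + 2)⁆⁆ = ∑ p, (S * N) i p • w p := by
    rw [hww, lie_sum]
    simp only [lie_smul, hN, Finset.smul_sum, smul_smul]
    rw [Finset.sum_comm]
    simp only [Matrix.mul_apply, Finset.sum_smul]
  -- This is the derivation property of ad z: on the cyclic brackets it acts by the trace of N minus
  -- the transpose of N.
  have hder : S * N + (S * N).transpose = N.trace • S := by
    have key (i : Fin 3) : ⁅z, ⁅w (i + 1), w (i + 2)⁆⁆ =
        N.trace • ⁅w (i + 1), w (i + 2)⁆ - ∑ l, N l i • ⁅w (l + 1), w (l + 2)⁆ := by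
      rw [leibniz_lie, hN, hN, Matrix.trace, Fin.sum_univ_three, Fin.sum_univ_three,
        Fin.sum_univ_three, Fin.sum_univ_three]
      simp only [add_lie, lie_add, smul_lie, lie_smul, Matrix.diag_apply]
      have e10 : ⁅w 1, w 0⁆ = -⁅w 0, w 1⁆ := (lie_skew _ _).symm
      have e21 : ⁅w 2, w 1⁆ = -⁅w 1, w 2⁆ := (lie_skew _ _).symm
      have e02 : ⁅w 0, w 2⁆ = -⁅w 2, w 0⁆ := (lie_skew _ _).symm
      have a1 : (1 : Fin 3) + 1 = 2 := rfl
      have a2 : (1 : Fin 3) + 2 = 0 := rfl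
      have a3 : (2 : Fin 3) + 1 = 0 := rfl
      have a4 : (2 : Fin 3) + 2 = 1 := rfl
      fin_cases i <;>
        simp only [Fin.isValue, Fin.zero_eta, Fin.mk_one, Fin.reduceFinMk, zero_add, a1, a2, a3, a4,
          lie_self, e10, e21, e02] <;> module
    ext i p
    have h := (hSN i).symm.trans (key i)
    simp only [hww, Finset.smul_sum, smul_smul] at h
    rw [Finset.sum_comm] at h
    simp only [← Finset.sum_smul, ← Finset.sum_sub_distrib, ← sub_smul] at h
    have hp := congrFun (congrArg A h) p
    rw [hAι, hAι] at hp
    rw [Matrix.add_apply, hp, Matrix.transpose_apply, Matrix.smul_apply, smul_eq_mul,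
      Matrix.mul_apply]
    simp only [hsymm p, mul_comm (N _ i)]
    ring
  -- Multiplying `hder` by S⁻¹ and taking traces gives 2 tr N = 3 tr N. Then S N is antisymmetric,
  -- and the choice of z makes it zero.
  have htr : N.trace = 0 := by
    have hinv : S⁻¹ * S = 1 := Matrix.nonsing_inv_mul _ hS
    have hST : S.transpose = S := by ext i j; exact hsymm j i
    have h1 : (S⁻¹ * (S * N)).trace = N.trace := by rw [← Matrix.mul_assoc, hinv, Matrix.one_mul]
    have h2 : (S⁻¹ * (S * N).transpose).trace = N.trace := by
      rw [Matrix.transpose_mul, hST, Matrix.trace_mul_comm, Matrix.mul_assoc,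
        Matrix.mul_nonsing_inv _ hS, Matrix.mul_one, Matrix.trace_transpose]
    have h3 := congrArg (fun M => (S⁻¹ * M).trace) hder
    simp only [Matrix.mul_add, Matrix.trace_add, h1, h2, Matrix.mul_smul, hinv, Matrix.trace_smul,
      Matrix.trace_one, Fintype.card_fin, smul_eq_mul] at h3
    push_cast at h3
    linarith
  have hR : S * N = 0 := by
    rw [htr, zero_smul] at hder
    have hr (i p : Fin 3) : (S * N) i p + (S * N) p i = 0 :=
      congrFun (congrFun hder i) p
    have hA' (i p : Fin 3) : (S * N) i p = A ⁅z, ⁅w (i + 1), w (i + 2)⁆⁆ p := by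
      rw [hSN, hAι]
    have z01 : (S * N) 0 1 = 0 := (hA' 0 1).trans (congrFun hz 0)
    have z02 : (S * N) 0 2 = 0 := (hA' 0 2).trans (congrFun hz 1)
    have z12 : (S * N) 1 2 = 0 := (hA' 1 2).trans (congrFun hz 2)
    have := hr 0 0
    have := hr 1 1
    have := hr 2 2
    have := hr 0 1
    have := hr 0 2
    have := hr 1 2
    ext i p
    fin_cases i <;> fin_cases p <;> simp only [Fin.isValue, Fin.zero_eta, Fin.mk_one,
      Fin.reduceFinMk, Matrix.zero_apply] <;> linarith
  have hN0 : N = 0 := by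
    rw [← Matrix.one_mul N, ← Matrix.nonsing_inv_mul _ hS, Matrix.mul_assoc, hR, Matrix.mul_zero]
  have hzw (j : Fin 3) : ⁅z, w j⁆ = 0 := by simp [hN, hN0]
  -- The center of P is trivial because the three cyclic brackets are linearly independent.
  refine ⟨z, fun hzP => hz0 ?_, hzw⟩
  have hz' := hAP z hzP
  generalize A z = c at hz'
  have hf (d : Fin 3 → ℝ) (hd : ∑ j, d j • ⁅w (j + 1), w (j + 2)⁆ = 0) : d = 0 := by
    refine Matrix.eq_zero_of_vecMul_eq_zero hS.ne_zero (M := S) ?_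
    ext m
    refine Fintype.linearIndependent_iff.1 hw _ ?_ m
    rw [← hd]
    simp only [hww, Finset.smul_sum, smul_smul, Matrix.vecMul, dotProduct, Finset.sum_smul]
    rw [Finset.sum_comm]
  have e10 : ⁅w 1, w 0⁆ = -⁅w 0, w 1⁆ := (lie_skew _ _).symm
  have e21 : ⁅w 2, w 1⁆ = -⁅w 1, w 2⁆ := (lie_skew _ _).symm
  have hf' (a b c : ℝ) (h : a • ⁅w 1, w 2⁆ + b • ⁅w 2, w 0⁆ + c • ⁅w 0, w 1⁆ = 0) :
      ![a, b, c] = 0 := hf _ (by rw [← h, Fin.sum_univ_three]; rfl)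
  have hc1 := hf' (-c 2) 0 (c 0) (by
    rw [← hzw 1, ← hz']
    simp only [Fin.sum_univ_three, add_lie, smul_lie, lie_self, e21]
    module)
  have hc0 := hf' 0 (c 2) (-c 1) (by
    rw [← hzw 0, ← hz']
    simp only [Fin.sum_univ_three, add_lie, smul_lie, lie_self, e10]
    module)
  have c0 := congrFun hc1 2
  have c2 := congrFun hc0 1
  have c1 := congrFun hc0 2
  simp only [Matrix.cons_val, Pi.zero_apply, neg_eq_zero] at c0 c1 c2
  rw [← hz', Fin.sum_univ_three, c0, c1, c2]
  simp

end Perfect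

/-! ### The two cases of the direct sum. -/

section Product

variable {g₄ g₃ : Type*} [LieRing g₄] [LieAlgebra ℝ g₄] [LieRing g₃] [LieAlgebra ℝ g₃]

theorem admitsCocalibratedG2Structure_of_perfect_right (h₄ : Module.finrank ℝ g₄ = 4)
    (h₃ : Module.finrank ℝ g₃ = 3) (hP : IsPerfectIdeal (⊤ : Submodule ℝ g₃)) :
    AdmitsCocalibratedG2Structure (g₄ × g₃) := by
  have : FiniteDimensional ℝ g₃ := Module.finite_of_finrank_eq_succ h₃
  have : FiniteDimensional ℝ g₄ := Module.finite_of_finrank_eq_succ h₄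
  obtain ⟨w, S, hw, hspan, hS, hsymm, hww⟩ := exists_structure_matrix hP (by rw [finrank_top, h₃])
  let u := Module.finBasisOfFinrankEq ℝ g₄ h₄
  let w' : Module.Basis (Fin 3) ℝ g₃ := Module.Basis.mk hw hspan.ge
  let e : Module.Basis (Fin (4 + 3)) ℝ (g₄ × g₃) := (u.prod w').reindex finSumFinEquiv
  have he (x : Fin 4 ⊕ Fin 3) : e (finSumFinEquiv x) = u.prod w' x := by
    rw [Module.Basis.reindex_apply, Equiv.symm_apply_apply]
  have heu (i : Fin 4) : e (i.castAdd 3) = (u i, 0) :=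
    (he (Sum.inl i)).trans (by simp)
  have hew (j : Fin 3) : e (j.natAdd 4) = (0, w j) :=
    (he (Sum.inr j)).trans (by simp [w'])
  refine admitsCocalibratedG2Structure_of_basis e S hS hsymm (fun i j => ?_) (fun i j => ?_)
    fun j => ?_
  · rw [heu, hew, LieAlgebra.Prod.bracket_apply]
    simp
  · have h : ⁅e (i.castAdd 3), e (j.castAdd 3)⁆ =
        ∑ k, u.repr ⁅u i, u j⁆ k • e (Fin.castAdd 3 k) := by
      simp only [heu, LieAlgebra.Prod.bracket_apply, Prod.smul_mk, lie_self, smul_zero]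
      rw [Prod.ext_iff, Prod.fst_sum, Prod.snd_sum]
      simp [u.sum_repr]
    rw [h]
    exact Submodule.sum_mem _ fun k _ =>
      Submodule.smul_mem _ _ (Submodule.subset_span ⟨k, rfl⟩)
  · rw [hew, hew, LieAlgebra.Prod.bracket_apply]
    simp only [hew, hww, Prod.smul_mk, lie_self, smul_zero]
    rw [Prod.ext_iff, Prod.fst_sum, Prod.snd_sum]
    simp

/-- Here W is P and U is ℝz × g₃, where z spans the central complement of P in g₄. -/
theorem admitsCocalibratedG2Structure_of_perfect_left (h₄ : Module.finrank ℝ g₄ = 4)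
    (h₃ : Module.finrank ℝ g₃ = 3) {P : Submodule ℝ g₄} (hP : IsPerfectIdeal P)
    (hP3 : Module.finrank ℝ P = 3) :
    AdmitsCocalibratedG2Structure (g₄ × g₃) := by
  have : FiniteDimensional ℝ g₃ := Module.finite_of_finrank_eq_succ h₃
  have : FiniteDimensional ℝ g₄ := Module.finite_of_finrank_eq_succ h₄
  obtain ⟨w, S, hw, hspan, hS, hsymm, hww⟩ := exists_structure_matrix hP hP3
  obtain ⟨z, hzP, hz⟩ := exists_central_complement h₄ hP hw hspan hS hsymm hww
  let v := Module.finBasisOfFinrankEq ℝ g₃ h₃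
  have hwz : LinearIndependent ℝ (Sum.elim w fun _ : Fin 1 => z) := by
    refine hw.sum_type (LinearIndependent.of_subsingleton 0 fun h => hzP ?_) ?_
    · rw [h]
      exact P.zero_mem
    · rw [hspan, Set.range_const, Submodule.disjoint_span_singleton']
      · exact hzP
      · exact fun h => hzP (h ▸ P.zero_mem)
  let b : Module.Basis (Fin 3 ⊕ Fin 1) ℝ g₄ :=
    basisOfLinearIndependentOfCardEqFinrank hwz (by simp [h₄])
  -- The resulting order is z, then the basis of g₃, then the basis of P.
  let σ : (Fin 3 ⊕ Fin 1) ⊕ Fin 3 ≃ Fin (4 + 3) :=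
    (Equiv.sumAssoc (Fin 3) (Fin 1) (Fin 3)).trans ((Equiv.sumComm _ _).trans
      ((Equiv.sumCongr finSumFinEquiv (Equiv.refl _)).trans finSumFinEquiv))
  let e : Module.Basis (Fin (4 + 3)) ℝ (g₄ × g₃) := (b.prod v).reindex σ
  have he (x : (Fin 3 ⊕ Fin 1) ⊕ Fin 3) : e (σ x) = b.prod v x := by
    rw [Module.Basis.reindex_apply, Equiv.symm_apply_apply]
  have hez (i : Fin 1) : e (Fin.castAdd 3 (i.castAdd 3)) = (z, 0) :=
    (he (Sum.inl (Sum.inr i))).trans (by simp [b])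
  have hev (i : Fin 3) : e (Fin.castAdd 3 (i.natAdd 1)) = (0, v i) :=
    (he (Sum.inr i)).trans (by simp)
  have hew (j : Fin 3) : e (j.natAdd 4) = (w j, 0) :=
    (he (Sum.inl (Sum.inl j))).trans (by simp [b])
  refine admitsCocalibratedG2Structure_of_basis e S hS hsymm (fun i j => ?_) (fun i j => ?_)
    fun j => ?_
  · refine Fin.addCases (m := 1) (n := 3) (fun i => ?_) (fun i => ?_) i
    · rw [hez, hew, LieAlgebra.Prod.bracket_apply]
      simp [hz]
    · rw [hev, hew, LieAlgebra.Prod.bracket_apply]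
      simp
  · have hmem (x : g₃) : ((0 : g₄), x) ∈
        Submodule.span ℝ (Set.range fun i : Fin 4 => e (i.castAdd 3)) := by
      have h : ((0 : g₄), x) = ∑ k, v.repr x k • e (Fin.castAdd 3 (Fin.natAdd 1 k)) := by
        simp only [hev, Prod.smul_mk, smul_zero]
        rw [Prod.ext_iff, Prod.fst_sum, Prod.snd_sum]
        simp [v.sum_repr]
      rw [h]
      exact Submodule.sum_mem _ fun k _ =>
        Submodule.smul_mem _ _ (Submodule.subset_span ⟨_, rfl⟩)
    refine Fin.addCases (m := 1) (n := 3) (fun i => ?_) (fun i => ?_) i <;>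
      refine Fin.addCases (m := 1) (n := 3) (fun j => ?_) (fun j => ?_) j <;>
      simp only [hez, hev, LieAlgebra.Prod.bracket_apply, lie_self, lie_zero, zero_lie] <;>
      exact hmem _
  · rw [hew, hew, LieAlgebra.Prod.bracket_apply]
    simp only [hew, hww, Prod.smul_mk, lie_self, smul_zero]
    rw [Prod.ext_iff, Prod.fst_sum, Prod.snd_sum]
    simp

end Product

theorem corollary3p5 {g₄ g₃ : Type*} [LieRing g₄] [LieAlgebra ℝ g₄] [LieRing g₃] [LieAlgebra ℝ g₃]
    (h₄ : Module.finrank ℝ g₄ = 4) (h₃ : Module.finrank ℝ g₃ = 3)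
    (hns : ¬ LieAlgebra.IsSolvable (g₄ × g₃)) :
    AdmitsCocalibratedG2Structure (g₄ × g₃) := by
  have : FiniteDimensional ℝ g₃ := Module.finite_of_finrank_eq_succ h₃
  have : FiniteDimensional ℝ g₄ := Module.finite_of_finrank_eq_succ h₄
  obtain ⟨P, hP, hP0⟩ := exists_isPerfectIdeal hns
  have hP₄ := hP.map (LieHom.fst ℝ g₄ g₃) LieHom.fst_surjective
  have hP₃ := hP.map (LieHom.snd ℝ g₄ g₃) LieHom.snd_surjective
  set P₄ := P.map (LieHom.fst ℝ g₄ g₃ : g₄ × g₃ →ₗ[ℝ] g₄) with hP₄def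
  set P₃ := P.map (LieHom.snd ℝ g₄ g₃ : g₄ × g₃ →ₗ[ℝ] g₃) with hP₃def
  -- A subspace of the product is zero if both of its projections are, so P₄ is nonzero when P₃
  -- vanishes.
  by_cases h3 : P₃ = ⊥
  · have h4 : P₄ ≠ ⊥ := by
      intro h4
      refine hP0 ((Submodule.eq_bot_iff _).2 fun x hx => Prod.ext ?_ ?_)
      · exact (Submodule.eq_bot_iff _).1 h4 _ (Submodule.mem_map_of_mem hx)
      · exact (Submodule.eq_bot_iff _).1 h3 _ (Submodule.mem_map_of_mem hx)
    refine admitsCocalibratedG2Structure_of_perfect_left h₄ h₃ hP₄ ?_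
    have h1 := hP₄.three_le_finrank h4
    have h2 := Submodule.finrank_le P₄
    have h5 : Module.finrank ℝ P₄ ≠ 4 := fun h =>
      not_isPerfectIdeal_top h₄ (Submodule.eq_top_of_finrank_eq (h.trans h₄.symm) ▸ hP₄)
    omega
  · refine admitsCocalibratedG2Structure_of_perfect_right h₄ h₃ ?_
    have h1 := hP₃.three_le_finrank h3
    have h2 := Submodule.finrank_le P₃
    exact Submodule.eq_top_of_finrank_eq (show Module.finrank ℝ P₃ = _ by omega) ▸ hP₃
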